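/- Let $\sigma(x)=\max\{x,0\}$, let $N$ be a standard normal random variable and, for $q\ge 0$ and $\eta,y\in\mathbb R$, put $$\kappa(\eta;q)=\log\mathbb E\big[e^{\eta\,\sigma(\sqrt q N)^2}\big]\in(-\infty,\infty],\qquad \kappa^*(y;q)=\sup_{\eta\in\mathbb R}\{\eta y-\kappa(\eta;q)\},\qquad y(q)=\mathbb E[\sigma(\sqrt qN)^2].$$ **(A) The function $\kappa$.** For $q>0$, $\kappa(\eta;q)=\log\frac{(1-2\eta q)^{-1/2}+1}{2}$ if $\eta<\frac1{2q}$ and $\kappa(\eta;q)=\infty$ if $\eta\ge\frac1{2q}$; moreover $\kappa(\eta;0)=0$ for all $\eta$. For every $q\ge0$, $\kappa(\cdot;q)$ is finite in a neighbourhood of $0$, essentially smooth (convex, with effective domain of non-empty interior, differentiable on this interior, and with $|\kappa'|\to\infty$ at its boundary points) and lower semicontinuous. **(B) The function $\kappa^*$.** The function $f(z)=\frac{z^3}{z+1}$ is a bijection of $(0,\infty)$ onto itself; let $f^{\leftarrow}$ be its inverse. Let $q>0$. For $\eta<\frac1{2q}$, $\kappa'(\eta;q)=\frac{q(1-2\eta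 q)^{-3/2}}{(1-2\eta q)^{-1/2}+1}$. For $y>0$ the equation $\kappa'(\eta;q)=y$ has exactly one solution $\eta=\eta_{y,q}$ in $(-\infty,\frac1{2q})$, namely $\eta_{y,q}=\frac{1-(f^{\leftarrow}(y/q))^{-2}}{2q}$; it satisfies $(1-2\eta_{y,q}q)^{-1/2}=f^{\leftarrow}(y/q)$, and $$\kappa^*(y;q)=\eta_{y,q}\,y-\kappa(\eta_{y,q};q)=\frac{1-(f^{\leftarrow}(y/q))^{-2}}{2q}\,y-\log\frac{f^{\leftarrow}(y/q)+1}{2}.$$ Moreover $\kappa^*(0;q)=\log 2$, and $\kappa^*(y;q)=\infty$ for $y<0$. **(C) The network.** Let $L,n_0,n_{L+1}\ge1$ be fixed integers, $C_b\ge0$, $C_W>0$, $x\in\mathbb R^{n_0}$. For each $n$ let $n_1(n),\dots,n_L(n)$ be positive integers with $n_\ell(n)\to\infty$, such that for some $\widehat\ell\in\{1,\dots,L\}$ and $\gamma_1,\dots,\gamma_L\in[1,\infty]$ one has $n_\ell(n)/n_{\widehat\ell}(n)\to\gamma_\ell$ for all $\ell$; put $v_n^*=n_{\widehat\ell}(n)$.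 Consider the network $$Z^{(1)}_i(x)=b^{(1)}_i+\sum_{r=1}^{n_0}W^{(1)}_{ir}x_r,\qquad Z^{(\ell+1)}_i(x)=b^{(\ell+1)}_i+\sum_{j=1}^{n_\ell(n)}W^{(\ell+1)}_{ij}\sigma(Z^{(\ell)}_j(x))\quad(1\le\ell\le L),$$ where, for each $n$, all biases $b_i^{(\ell)}\sim\mathcal N(0,C_b)$ ($1\le\ell\le L+1$) and weights $W^{(\ell+1)}_{ij}\sim\mathcal N(0,C_W/n_\ell)$ ($0\le\ell\le L$) are independent. Let $Z^{(L+1)}(x)\in\mathbb R^{n_{L+1}}$ be the output and $\|\cdot\|$ the Euclidean norm. Set $g^{(0)}(x)=C_b+\frac{C_W}{n_0}\sum_r x_r^2$ and, for $g,g'\ge C_b$, $$J_\ell(g|g')=\begin{cases}\gamma_\ell\,\kappa^*\big(\tfrac{g-C_b}{C_W};g'\big)&\gamma_\ell<\infty,\\ 0\text{ if }g=C_b+C_W\,y(g'),\ \infty\text{ otherwise}&\gamma_\ell=\infty,\end{cases}$$ $$I_G(g)=\inf\Big\{\sum_{\ell=1}^LJ_\ell(g^{(\ell)}|g^{(\ell-1)}):\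 g^{(0)}=g^{(0)}(x),\ g^{(1)},\dots,g^{(L-1)}\ge C_b,\ g^{(L)}=g\Big\},$$ and let $\widehat g^{(0)}=g^{(0)}(x)$, $\widehat g^{(\ell)}=C_b+C_W\,y(\widehat g^{(\ell-1)})$ for $1\le \ell\le L$. *Large deviations.* The sequence $\{Z^{(L+1)}(x)/\sqrt{v_n^*}\}_n$ satisfies the large deviation principle on $\mathbb R^{n_{L+1}}$ with speed $v_n^*$ and good rate function $$I(z)=\inf\{I_G(g)+\|r\|^2/2:\ g\ge C_b,\ r\in\mathbb R^{n_{L+1}},\ \sqrt g\,r=z\}.$$ *Moderate deviations.* For every sequence of positive numbers $a_n$ with $a_n\to0$ and $a_nv_n^*\to\infty$, the sequence $\{\sqrt{a_n}\,Z^{(L+1)}(x)\}_n$ satisfies the large deviation principle on $\mathbb R^{n_{L+1}}$ with speed $1/a_n$ and good rate function $$\widetilde I(z)=\inf\{\|r\|^2/2:\ r\in\mathbb R^{n_{L+1}},\ \sqrt{\widehat g^{(L)}}\,r=z\};$$ if $\widehat g^{(L)}>0$, then $\widetilde I(z)=\big\|z/\sqrt{\widehat g^{(L)}}\big\|^2/2$.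 -/

import Mathlib

open MeasureTheory ProbabilityTheory Filter Topology
open scoped ENNReal NNReal

namespace GaussianNN

noncomputable section

/-- The ReLU function. -/
def relu (x : ℝ) : ℝ := max x 0

/-! ### Large deviation principles -/

/-- `I` is a rate function on `X`: it takes values in `[0, ∞]` and is lower semicontinuous. -/
structure IsRateFunction {X : Type*} [TopologicalSpace X] (I : X → EReal) : Prop where
  nonneg : ∀ x, 0 ≤ I x
  lsc : LowerSemicontinuous I

/-- A good rate function: all level sets are compact. -/
structure IsGoodRateFunction {X : Type*} [TopologicalSpace X] (I : X → EReal) : Prop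
    extends IsRateFunction I where
  compact_level : ∀ c : ℝ, 0 ≤ c → IsCompact {x | I x ≤ (c : EReal)}

/-- A speed function: a sequence of positive numbers that tends to infinity. -/
structure IsSpeed (v : ℕ → ℝ) : Prop where
  pos : ∀ n, 0 < v n
  tendsto : Tendsto v atTop atTop

/-- The measures `π n` satisfy the large deviation principle with speed `v` and rate function `I`;
logarithms of probabilities are taken in `[-∞, 0]`, with `log 0 = -∞`. -/
structure SatisfiesLDP {X : Type*} [TopologicalSpace X] [MeasurableSpace X]
    (π : ℕ → Measure X) (v : ℕ → ℝ) (I : X → EReal) : Prop where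
  speed : IsSpeed v
  rate : IsRateFunction I
  upper : ∀ C : Set X, IsClosed C →
    limsup (fun n => ((1 / v n : ℝ) : EReal) * ENNReal.log (π n C)) atTop ≤ -(⨅ x ∈ C, I x)
  lower : ∀ O : Set X, IsOpen O →
    -(⨅ x ∈ O, I x) ≤ liminf (fun n => ((1 / v n : ℝ) : EReal) * ENNReal.log (π n O)) atTop

/-! ### Essentially smooth functions -/

/-- The effective domain of a function with values in `(-∞, ∞]`. -/
def effDomain (f : ℝ → EReal) : Set ℝ := {η | f η ≠ ⊤}

/-- Essentially smooth functions `f : ℝ → (-∞, ∞]`: `f` is convex, its effective domain has non-empty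
interior, and `f` is differentiable on this interior and steep at its boundary. -/
structure EssentiallySmooth (f : ℝ → EReal) : Prop where
  ne_bot : ∀ η, f η ≠ ⊥
  convex : Convex ℝ {p : ℝ × ℝ | f p.1 ≤ (p.2 : EReal)}
  nonempty : (interior (effDomain f)).Nonempty
  differentiable : ∀ η ∈ interior (effDomain f), DifferentiableAt ℝ (fun t => (f t).toReal) η
  steep : ∀ η ∈ frontier (interior (effDomain f)),
    Tendsto (fun t => |deriv (fun s => (f s).toReal) t|) (𝓝[interior (effDomain f)] η) atTop

/-! ### The Gaussian fully connected network, evaluated at one input -/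

variable {Ω : Type*}

/-- The fully connected network with activation `σ`, widths `N 0, N 1, …` (`N 0 = n₀`), biases
`b ℓ i` and weights `W ℓ i j` of layer `ℓ ≥ 1`, and input `x`: the value `preact σ N b W x ℓ i`
is `Z_i^{(ℓ+1)}(x)`. Neurons are numbered from `0`. -/
def preact (σ : ℝ → ℝ) (N : ℕ → ℕ) (b : ℕ → ℕ → Ω → ℝ) (W : ℕ → ℕ → ℕ → Ω → ℝ)
    {n₀ : ℕ} (x : Fin n₀ → ℝ) : ℕ → ℕ → Ω → ℝ
  | 0, i, ω => b 1 i ω + ∑ r : Fin n₀, W 1 i r ω * x r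
  | ℓ + 1, i, ω =>
      b (ℓ + 2) i ω +
        ∑ j ∈ Finset.range (N (ℓ + 1)), W (ℓ + 2) i j ω * σ (preact σ N b W x ℓ j ω)

/-- The output `Z^{(L+1)}(x)` of a network with `L` hidden layers, as a vector of `ℝ^m`. -/
def output (σ : ℝ → ℝ) (L m : ℕ) (N : ℕ → ℕ) (b : ℕ → ℕ → Ω → ℝ) (W : ℕ → ℕ → ℕ → Ω → ℝ)
    {n₀ : ℕ} (x : Fin n₀ → ℝ) (ω : Ω) : EuclideanSpace ℝ (Fin m) :=
  WithLp.toLp 2 fun h => preact σ N b W x L h ω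

/-- Indices `(ℓ, i)` of the biases: `1 ≤ ℓ ≤ L + 1` and `i < N ℓ`. -/
abbrev BiasIndex (L : ℕ) (N : ℕ → ℕ) : Type :=
  {p : ℕ × ℕ // 1 ≤ p.1 ∧ p.1 ≤ L + 1 ∧ p.2 < N p.1}

/-- Indices `(ℓ, i, j)` of the weights: `1 ≤ ℓ ≤ L + 1`, `i < N ℓ` and `j < N (ℓ - 1)`. -/
abbrev WeightIndex (L : ℕ) (N : ℕ → ℕ) : Type :=
  {p : ℕ × ℕ × ℕ // 1 ≤ p.1 ∧ p.1 ≤ L + 1 ∧ p.2.1 < N p.1 ∧ p.2.2 < N (p.1 - 1)}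

/-- Gaussian random parameters: the biases are centered normal with variance `Cb`, the weights of
layer `ℓ` are centered normal with variance `CW / N (ℓ - 1)`, and all of them are independent. -/
structure IsGaussianInit [MeasurableSpace Ω] (P : Measure Ω) (Cb CW : ℝ) (L : ℕ) (N : ℕ → ℕ)
    (b : ℕ → ℕ → Ω → ℝ) (W : ℕ → ℕ → ℕ → Ω → ℝ) : Prop where
  bias : ∀ p : BiasIndex L N, HasLaw (b p.1.1 p.1.2) (gaussianReal 0 Cb.toNNReal) P
  weight : ∀ p : WeightIndex L N, HasLaw (W p.1.1 p.1.2.1 p.1.2.2)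
    (gaussianReal 0 (CW / (N (p.1.1 - 1) : ℝ)).toNNReal) P
  indep : iIndepFun (Sum.elim (fun p : BiasIndex L N => b p.1.1 p.1.2)
    (fun p : WeightIndex L N => W p.1.1 p.1.2.1 p.1.2.2)) P

/-- The condition on the widths: `N n ℓ` is the width of layer `ℓ` of the `n`-th network. The
hidden widths diverge and, for the reference layer `lh`, the ratios `N n ℓ / N n lh` converge
to limits `γ ℓ ∈ [1, ∞]`. -/
structure WidthCondition (L n₀ m : ℕ) (N : ℕ → ℕ → ℕ) (lh : ℕ) (γ : ℕ → ℝ≥0∞) : Prop where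
  input : ∀ n, N n 0 = n₀
  output : ∀ n, N n (L + 1) = m
  pos : ∀ n, ∀ ℓ ≤ L + 1, 0 < N n ℓ
  diverge : ∀ ℓ, 1 ≤ ℓ → ℓ ≤ L → Tendsto (fun n => N n ℓ) atTop atTop
  ref : 1 ≤ lh ∧ lh ≤ L
  one_le : ∀ ℓ, 1 ≤ ℓ → ℓ ≤ L → 1 ≤ γ ℓ
  ratio : ∀ ℓ, 1 ≤ ℓ → ℓ ≤ L →
    Tendsto (fun n => (N n ℓ : ℝ≥0∞) / (N n lh : ℝ≥0∞)) atTop (𝓝 (γ ℓ))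

/-! ### The rate functions -/

/-- `κ(η; q) = log E[exp (η σ(√q N)²)]` for a standard normal `N`, with values in `(-∞, ∞]`. -/
def kappa (σ : ℝ → ℝ) (η q : ℝ) : EReal :=
  ENNReal.log (∫⁻ t, ENNReal.ofReal (Real.exp (η * σ (√q * t) ^ 2)) ∂(gaussianReal 0 1))

/-- The Fenchel-Legendre transform `κ*(y; q)`. -/
def kappaStar (σ : ℝ → ℝ) (y q : ℝ) : EReal :=
  ⨆ η : ℝ, ((η * y : ℝ) : EReal) - kappa σ η q

/-- `y(q) = E[σ(√q N)²]` for a standard normal `N`. -/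
def meanSq (σ : ℝ → ℝ) (q : ℝ) : ℝ := ∫ t, σ (√q * t) ^ 2 ∂(gaussianReal 0 1)

open Classical in
/-- `Δ(r; r₀)`, equal to `0` if `r = r₀` and to `∞` otherwise. -/
def Delta (r r₀ : ℝ) : EReal := if r = r₀ then 0 else ⊤

open Classical in
/-- `J(g | g')` for a layer with limiting width ratio `γ`. -/
def J (σ : ℝ → ℝ) (Cb CW : ℝ) (γ : ℝ≥0∞) (g g' : ℝ) : EReal :=
  if γ = ⊤ then Delta g (Cb + CW * meanSq σ g')
  else (γ.toReal : EReal) * kappaStar σ ((g - Cb) / CW) g'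

/-- The variance `g^{(0)}(x) = C_b + (C_W / n₀) ∑ x_r²` of the first layer. -/
def initVar (Cb CW : ℝ) {n₀ : ℕ} (x : Fin n₀ → ℝ) : ℝ := Cb + CW / n₀ * ∑ r, x r * x r

/-- `I_{G^{(L)}(x)}(g)`: the infimum of `∑_{ℓ=1}^L J(g^{(ℓ)} | g^{(ℓ-1)})` over the paths with
`g^{(0)} = g^{(0)}(x)`, `g^{(1)}, …, g^{(L-1)} ≥ C_b` and `g^{(L)} = g`. -/
def rateG (σ : ℝ → ℝ) (Cb CW : ℝ) (L : ℕ) (γ : ℕ → ℝ≥0∞) {n₀ : ℕ} (x : Fin n₀ → ℝ) (g : ℝ) :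
    EReal :=
  ⨅ (p : ℕ → ℝ) (_ : p 0 = initVar Cb CW x ∧ p L = g ∧ ∀ ℓ, 1 ≤ ℓ → ℓ < L → Cb ≤ p ℓ),
    ∑ ℓ ∈ Finset.range L, J σ Cb CW (γ (ℓ + 1)) (p (ℓ + 1)) (p ℓ)

/-- The large deviation rate function
`I_{Z^{(L+1)}(x)}(z) = inf {I_{G^{(L)}(x)}(g) + ‖r‖²/2 : g ≥ C_b, √g r = z}`. -/
def rateLD (σ : ℝ → ℝ) (Cb CW : ℝ) (L m : ℕ) (γ : ℕ → ℝ≥0∞) {n₀ : ℕ} (x : Fin n₀ → ℝ)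
    (z : EuclideanSpace ℝ (Fin m)) : EReal :=
  ⨅ (g : ℝ) (r : EuclideanSpace ℝ (Fin m)) (_ : Cb ≤ g ∧ √g • r = z),
    rateG σ Cb CW L γ x g + ((‖r‖ ^ 2 / 2 : ℝ) : EReal)

/-- The limiting variances: `ĝ^{(0)} = g^{(0)}(x)` and `ĝ^{(ℓ)} = C_b + C_W y(ĝ^{(ℓ-1)})`. -/
def limVar (σ : ℝ → ℝ) (Cb CW : ℝ) {n₀ : ℕ} (x : Fin n₀ → ℝ) : ℕ → ℝ
  | 0 => initVar Cb CW x
  | ℓ + 1 => Cb + CW * meanSq σ (limVar σ Cb CW x ℓ)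

/-- The moderate deviation rate function `inf {‖r‖²/2 : √ĝ^{(L)} r = z}`. -/
def rateMD (σ : ℝ → ℝ) (Cb CW : ℝ) (L m : ℕ) {n₀ : ℕ} (x : Fin n₀ → ℝ)
    (z : EuclideanSpace ℝ (Fin m)) : EReal :=
  ⨅ (r : EuclideanSpace ℝ (Fin m)) (_ : √(limVar σ Cb CW x L) • r = z),
    ((‖r‖ ^ 2 / 2 : ℝ) : EReal)

/-! ### The function that inverts the derivative of `κ` for ReLU -/

/-- `f(z) = z³ / (z + 1)`, considered on `(0, ∞)`. -/
def cubicRatio (z : ℝ) : ℝ := z ^ 3 / (z + 1)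

/-- The inverse of `f : (0, ∞) → (0, ∞)`. -/
def cubicRatioInv : ℝ → ℝ := Function.invFunOn cubicRatio (Set.Ioi 0)

/-- `η_{y,q} = (1 - f⁻¹(y/q)⁻²) / (2q)`. -/
def etaStar (y q : ℝ) : ℝ := (1 - (cubicRatioInv (y / q) ^ 2)⁻¹) / (2 * q)

end

end GaussianNN

open GaussianNN

/-! Given the previous layer, the neurons of a layer are independent centered Gaussians whose common
variance is C_b + C_W times the mean of the squared activations. Since ReLU is positively
homogeneous, a layer of variance g passes on the variance C_b + C_W g S, where S is the mean of n_ℓ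
independent copies of σ(N)² and is independent of g. So the variances form a Markov chain driven by
independent means (`varLaw`), and the output is √g times an independent standard Gaussian vector
(`map_smul_output`). This removes all the network structure from the problem.

If n_ℓ / v tends to γ, then S satisfies a Cramér-type principle at speed v: the rate is γ κ*(·; 1)
for finite γ, and S is frozen at its mean 1/2 for γ = ∞ (`localLDP_reluMeanLaw`). A standard
Gaussian vector divided by √v has rate ‖r‖²/2. A contraction principle for independent pairs
(`LocalLDP.map_prod`), used once per layer and once at the output, combines them. Its nested infima
are then identified with the infimum over paths (`rateG_eq_varRate`, `rateLD_eq`). All this is done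
with local bounds on balls together with exponential tightness, a form that is easy to propagate and
that implies the full principle with a good rate function.

Moderate deviations need no separate argument: at speed v = 1/a_n every ratio n_ℓ / v diverges, so
every γ is ∞ and the variances are frozen at their limits (`rateLD_top`).

The formulas for κ and κ* also reduce to q = 1 by homogeneity. With w = (1 - 2c)^(-1/2), the
logarithmic moment generating function is log((w + 1)/2). Since w' = w³, its derivative is f(w) =
w³/(w + 1), so solving for the maximiser in the Legendre transform amounts to inverting f. -/

namespace GaussianNN

/-! ### A local form of the large deviation principle -/

/-- The large deviation principle in terms of balls, with exponential tightness. -/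
structure LocalLDP {X : Type*} [PseudoMetricSpace X] [MeasurableSpace X]
    (π : ℕ → Measure X) (v : ℕ → ℝ) (I : X → EReal) : Prop where
  nonneg : ∀ x, 0 ≤ I x
  lower : ∀ x (c : ℝ), I x < c → ∀ δ > 0,
    ∀ᶠ n in atTop, Real.exp (-(c * v n)) ≤ (π n).real (Metric.ball x δ)
  upper : ∀ x (c : ℝ), (c : EReal) < I x → ∃ δ > 0,
    ∀ᶠ n in atTop, (π n).real (Metric.ball x δ) ≤ Real.exp (-(c * v n))
  tight : ∀ M : ℝ, ∃ K : Set X, IsCompact K ∧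
    ∀ᶠ n in atTop, (π n).real Kᶜ ≤ Real.exp (-(M * v n))

/-- Constant prefactors are invisible on the exponential scale once the exponent is lowered
slightly. This absorbs the cost of every finite union bound below. -/
lemma eventually_mul_exp_le {v : ℕ → ℝ} (hv : Tendsto v atTop atTop) (k : ℝ) {c c' : ℝ}
    (h : c < c') : ∀ᶠ n in atTop, k * Real.exp (-(c' * v n)) ≤ Real.exp (-(c * v n)) := by
  have h1 : Tendsto (fun n => (c' - c) * v n) atTop atTop := hv.const_mul_atTop (by linarith)
  filter_upwards [(Real.tendsto_exp_atTop.comp h1).eventually_ge_atTop k] with n hn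
  calc k * Real.exp (-(c' * v n)) ≤ Real.exp ((c' - c) * v n) * Real.exp (-(c' * v n)) := by
        gcongr; exact hn
    _ = Real.exp (-(c * v n)) := by rw [← Real.exp_add]; ring_nf

lemma exp_neg_mul_le_iff {v c c' : ℝ} (hv : 0 < v) :
    Real.exp (-(c * v)) ≤ Real.exp (-(c' * v)) ↔ c' ≤ c := by
  rw [Real.exp_le_exp, neg_le_neg_iff, mul_le_mul_iff_left₀ hv]

lemma log_ofReal_exp_mul {v c : ℝ} (hv : 0 < v) :
    ((1 / v : ℝ) : EReal) * ENNReal.log (ENNReal.ofReal (Real.exp (-(c * v)))) = ((-c : ℝ) : EReal) := by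
  rw [ENNReal.log_ofReal_of_pos (Real.exp_pos _), Real.log_exp, ← EReal.coe_mul]
  congr 1
  field_simp

section

variable {X : Type*} [PseudoMetricSpace X] [MeasurableSpace X] {π : ℕ → Measure X} {v : ℕ → ℝ}
  {I : X → EReal} [∀ n, IsProbabilityMeasure (π n)]

/-- If a point near `x` had a much smaller rate, a small ball around it would fit into the ball of
the upper bound at `x` and be too heavy for it. -/
lemma LocalLDP.lowerSemicontinuous (h : LocalLDP π v I) (hv : IsSpeed v) :
    LowerSemicontinuous I := by
  intro x y hy
  obtain ⟨c, hyc, hc⟩ := EReal.lt_iff_exists_real_btwn.1 hy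
  obtain ⟨δ, hδ, hu⟩ := h.upper x c hc
  filter_upwards [Metric.ball_mem_nhds x hδ] with x' hx'
  refine hyc.trans_le (not_lt.1 fun hlt => ?_)
  obtain ⟨c', h1, h2⟩ := EReal.lt_iff_exists_real_btwn.1 hlt
  obtain ⟨ε, hε, hsub⟩ := Metric.isOpen_iff.1 Metric.isOpen_ball x' hx'
  obtain ⟨n, h3, h4⟩ := (hu.and (h.lower x' c' h1 ε hε)).exists
  have := (exp_neg_mul_le_iff (hv.pos n)).1 (h4.trans ((measureReal_mono hsub).trans h3))
  exact absurd (EReal.coe_lt_coe_iff.1 h2) (not_lt.2 this)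

/-- The level set at `c` lies in a compact set whose complement has mass at most exp(-(c + 1) v): a
point outside it with rate at most `c` would have a neighbourhood in the complement of mass at least
exp(-(c + 1/2) v). -/
lemma LocalLDP.isGoodRateFunction [T2Space X] (h : LocalLDP π v I) (hv : IsSpeed v) :
    IsGoodRateFunction I where
  nonneg := h.nonneg
  lsc := h.lowerSemicontinuous hv
  compact_level c _ := by
    obtain ⟨K, hK, hKn⟩ := h.tight (c + 1)
    refine hK.of_isClosed_subset ((h.lowerSemicontinuous hv).isClosed_preimage c) fun x hx => ?_
    by_contra hxK
    obtain ⟨ε, hε, hsub⟩ := Metric.isOpen_iff.1 hK.isClosed.isOpen_compl x hxK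
    have hx' : I x < ((c + 1 / 2 : ℝ) : EReal) :=
      lt_of_le_of_lt hx (EReal.coe_lt_coe_iff.2 (by linarith))
    obtain ⟨n, h3, h4⟩ := (hKn.and (h.lower x _ hx' ε hε)).exists
    have := (exp_neg_mul_le_iff (hv.pos n)).1 (h4.trans ((measureReal_mono hsub).trans h3))
    linarith

lemma LocalLDP.satisfiesLDP (h : LocalLDP π v I) (hv : IsSpeed v) : SatisfiesLDP π v I where
  speed := hv
  rate := ⟨h.nonneg, h.lowerSemicontinuous hv⟩
  upper C hC := by
    refine EReal.le_of_forall_lt_iff_le.1 fun z hz => ?_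
    obtain ⟨c', h1, h2⟩ := EReal.lt_iff_exists_real_btwn.1 (EReal.neg_lt_comm.1 hz)
    have hzc : -z < c' := by rw [← EReal.coe_lt_coe_iff]; exact_mod_cast h1
    obtain ⟨K, hK, hKn⟩ := h.tight c'
    -- Covering by finitely many balls, phrased as induction on subsets of `K`: the bound is local,
    -- and constants add up under unions.
    have key : ∃ k : ℝ, ∀ᶠ n in atTop, (π n).real (K ∩ C) ≤ k * Real.exp (-(c' * v n)) := by
      refine hK.induction_on (p := fun A => ∃ k : ℝ, ∀ᶠ n in atTop,
        (π n).real (A ∩ C) ≤ k * Real.exp (-(c' * v n))) ⟨0, by simp⟩ ?_ ?_ ?_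
      · rintro s t hst ⟨k, hk⟩
        refine ⟨k, hk.mono fun n hn => (measureReal_mono ?_).trans hn⟩
        exact Set.inter_subset_inter_left _ hst
      · rintro s t ⟨k, hk⟩ ⟨l, hl⟩
        refine ⟨k + l, ?_⟩
        filter_upwards [hk, hl] with n hn hn'
        rw [Set.union_inter_distrib_right, add_mul]
        exact (measureReal_union_le _ _).trans (add_le_add hn hn')
      · intro x _
        by_cases hx : x ∈ C
        · obtain ⟨δ, hδ, hu⟩ := h.upper x c' (h2.trans_le (iInf₂_le x hx))
          refine ⟨_, mem_nhdsWithin_of_mem_nhds (Metric.ball_mem_nhds x hδ), 1, ?_⟩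
          filter_upwards [hu] with n hn
          rw [one_mul]
          exact (measureReal_mono Set.inter_subset_left).trans hn
        · refine ⟨_, mem_nhdsWithin_of_mem_nhds (hC.isOpen_compl.mem_nhds hx), 0, ?_⟩
          simp
    obtain ⟨k, hk⟩ := key
    refine Filter.limsup_le_of_le (h := ?_)
    filter_upwards [hk, hKn, eventually_mul_exp_le hv.tendsto (k + 1) hzc] with n h3 h4 h5
    have h6 : (π n).real C ≤ Real.exp (-(-z * v n)) := by
      refine le_trans ?_ h5
      calc (π n).real C ≤ (π n).real ((K ∩ C) ∪ Kᶜ) := by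
            refine measureReal_mono fun x hx => ?_
            by_cases hxK : x ∈ K
            exacts [Or.inl ⟨hxK, hx⟩, Or.inr hxK]
        _ ≤ _ := (measureReal_union_le _ _).trans (by rw [add_mul, one_mul]; exact add_le_add h3 h4)
    calc _ ≤ ((1 / v n : ℝ) : EReal) * ENNReal.log (ENNReal.ofReal (Real.exp (-(-z * v n)))) := by
          refine mul_le_mul_of_nonneg_left (ENNReal.log_monotone ?_) ?_
          · rw [← ofReal_measureReal]
            exact ENNReal.ofReal_le_ofReal h6
          · exact EReal.coe_nonneg.2 (one_div_pos.2 (hv.pos n)).le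
      _ = _ := by rw [log_ofReal_exp_mul (hv.pos n), neg_neg]
  lower O hO := by
    rw [EReal.neg_le]
    refine le_iInf₂ fun x hx => ?_
    refine EReal.le_of_forall_lt_iff_le.1 fun c hc => ?_
    obtain ⟨ε, hε, hsub⟩ := Metric.isOpen_iff.1 hO x hx
    rw [EReal.neg_le]
    refine Filter.le_liminf_of_le (h := ?_)
    filter_upwards [h.lower x c hc ε hε] with n hn
    calc _ = ((1 / v n : ℝ) : EReal) * ENNReal.log (ENNReal.ofReal (Real.exp (-(c * v n)))) := by
          rw [log_ofReal_exp_mul (hv.pos n)]; rfl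
      _ ≤ _ := by
          refine mul_le_mul_of_nonneg_left (ENNReal.log_monotone ?_) ?_
          · rw [← ofReal_measureReal (μ := π n)]
            exact ENNReal.ofReal_le_ofReal (hn.trans (measureReal_mono hsub))
          · exact EReal.coe_nonneg.2 (one_div_pos.2 (hv.pos n)).le

end

/-! ### The contraction principle for independent pairs -/

/-- A bound on a sum of rates is distributed over the two summands, so that each factor of a product
measure can be estimated separately. Nonnegativity keeps `⊥` out of the extended sum. -/
lemma exists_real_add_eq_of_lt_add {a b : EReal} (ha : 0 ≤ a) (hb : 0 ≤ b) {c : ℝ}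
    (h : (c : EReal) < a + b) : ∃ c₁ c₂ : ℝ, (c₁ : EReal) < a ∧ (c₂ : EReal) < b ∧ c₁ + c₂ = c := by
  induction a with
  | bot => simp at ha
  | top =>
    refine ⟨c + 1, -1, EReal.coe_lt_top _, lt_of_lt_of_le ?_ hb, by ring⟩
    exact_mod_cast neg_one_lt_zero
  | coe a =>
    induction b with
    | bot => simp at hb
    | top =>
      refine ⟨-1, c + 1, lt_of_lt_of_le ?_ ha, EReal.coe_lt_top _, by ring⟩
      exact_mod_cast neg_one_lt_zero
    | coe b =>
      have h' : c < a + b := by exact_mod_cast h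
      refine ⟨a - (a + b - c) / 2, b - (a + b - c) / 2, ?_, ?_, by ring⟩ <;>
        rw [EReal.coe_lt_coe_iff] <;> linarith

lemma exists_real_add_eq_of_add_lt {a b : EReal} (ha : 0 ≤ a) (hb : 0 ≤ b) {c : ℝ}
    (h : a + b < (c : EReal)) : ∃ c₁ c₂ : ℝ, a < (c₁ : EReal) ∧ b < (c₂ : EReal) ∧ c₁ + c₂ = c := by
  induction a with
  | bot => simp at ha
  | top =>
    rw [EReal.top_add_of_ne_bot (by rintro rfl; simp at hb)] at h
    exact absurd h not_top_lt
  | coe a =>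
    induction b with
    | bot => simp at hb
    | top =>
      rw [EReal.coe_add_top] at h
      exact absurd h not_top_lt
    | coe b =>
      have h' : a + b < c := by exact_mod_cast h
      refine ⟨a + (c - a - b) / 2, b + (c - a - b) / 2, ?_, ?_, by ring⟩ <;>
        rw [EReal.coe_lt_coe_iff] <;> linarith

/-- Independent pairs satisfy the contraction principle. -/
lemma LocalLDP.map_prod {X S Y : Type*} [PseudoMetricSpace X] [MeasurableSpace X]
    [PseudoMetricSpace S] [MeasurableSpace S]
    [MetricSpace Y] [MeasurableSpace Y] [BorelSpace Y]
    {π : ℕ → Measure X} {μ : ℕ → Measure S} [∀ n, IsProbabilityMeasure (π n)]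
    [∀ n, IsProbabilityMeasure (μ n)] {v : ℕ → ℝ} {I : X → EReal} {J : S → EReal}
    (hI : LocalLDP π v I) (hJ : LocalLDP μ v J) (hv : IsSpeed v)
    {Φ : X × S → Y} (hΦ : Continuous Φ) (hΦm : Measurable Φ) :
    LocalLDP (fun n => ((π n).prod (μ n)).map Φ) v
      (fun y => ⨅ (x : X) (s : S) (_ : Φ (x, s) = y), I x + J s) := by
  have hmap : ∀ n y δ, (((π n).prod (μ n)).map Φ).real (Metric.ball y δ) =
      ((π n).prod (μ n)).real (Φ ⁻¹' Metric.ball y δ) := fun n y δ =>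
    map_measureReal_apply hΦm Metric.isOpen_ball.measurableSet
  have hprod : ∀ (n : ℕ) A B, ((π n).prod (μ n)).real (A ×ˢ B) = (π n).real A * (μ n).real B :=
    fun n A B => measureReal_prod_prod A B
  have htight : ∀ M : ℝ, ∃ K : Set (X × S), IsCompact K ∧
      ∀ᶠ n in atTop, ((π n).prod (μ n)).real Kᶜ ≤ Real.exp (-(M * v n)) := by
    intro M
    obtain ⟨K, hK, h1⟩ := hI.tight (M + 1)
    obtain ⟨K', hK', h2⟩ := hJ.tight (M + 1)
    refine ⟨K ×ˢ K', hK.prod hK', ?_⟩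
    filter_upwards [h1, h2, eventually_mul_exp_le hv.tendsto 2 (lt_add_one M)] with n h3 h4 h5
    refine le_trans ?_ h5
    calc ((π n).prod (μ n)).real (K ×ˢ K')ᶜ
        ≤ ((π n).prod (μ n)).real (Kᶜ ×ˢ Set.univ ∪ Set.univ ×ˢ K'ᶜ) := by
          refine measureReal_mono ?_
          rintro ⟨a, b⟩ h
          simp only [Set.mem_compl_iff, Set.mem_prod, not_and_or] at h
          simpa using h
      _ ≤ _ := (measureReal_union_le _ _).trans (by
          rw [hprod, hprod, two_mul]; simpa using add_le_add h3 h4)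
  refine ⟨fun y => ?_, fun y c hc δ hδ => ?_, fun y c hc => ?_, fun M => ?_⟩
  · exact le_iInf fun x => le_iInf fun s => le_iInf fun _ => add_nonneg (hI.nonneg x) (hJ.nonneg s)
  · simp only [iInf_lt_iff] at hc
    obtain ⟨x, s, rfl, hxs⟩ := hc
    obtain ⟨c₁, c₂, h1, h2, rfl⟩ := exists_real_add_eq_of_add_lt (hI.nonneg x) (hJ.nonneg s) hxs
    obtain ⟨ε, hε, hsub⟩ := Metric.isOpen_iff.1 (Metric.isOpen_ball.preimage hΦ) (x, s)
      (Metric.mem_ball_self hδ : Φ (x, s) ∈ Metric.ball (Φ (x, s)) δ)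
    filter_upwards [hI.lower x c₁ h1 ε hε, hJ.lower s c₂ h2 ε hε] with n h3 h4
    rw [hmap]
    calc Real.exp (-((c₁ + c₂) * v n))
        = Real.exp (-(c₁ * v n)) * Real.exp (-(c₂ * v n)) := by rw [← Real.exp_add]; ring_nf
      _ ≤ (π n).real (Metric.ball x ε) * (μ n).real (Metric.ball s ε) := by gcongr
      _ = ((π n).prod (μ n)).real (Metric.ball (x, s) ε) := by
          rw [← hprod, ball_prod_same]
      _ ≤ _ := measureReal_mono hsub
  · obtain ⟨c', h1, h2⟩ := EReal.lt_iff_exists_real_btwn.1 hc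
    obtain ⟨K, hK, hKn⟩ := htight c'
    -- The radius `δ` around `y` has to work for all of `K` at once; the compactness induction takes
    -- the minimum of two radii at each union.
    have key : ∃ k δ : ℝ, 0 < δ ∧ ∀ᶠ n in atTop, ((π n).prod (μ n)).real
        (K ∩ Φ ⁻¹' Metric.ball y δ) ≤ k * Real.exp (-(c' * v n)) := by
      refine hK.induction_on (p := fun A => ∃ k δ : ℝ, 0 < δ ∧ ∀ᶠ n in atTop,
        ((π n).prod (μ n)).real (A ∩ Φ ⁻¹' Metric.ball y δ) ≤ k * Real.exp (-(c' * v n)))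
        ⟨0, 1, one_pos, by simp⟩ ?_ ?_ ?_
      · rintro s t hst ⟨k, δ, hδ, hk⟩
        refine ⟨k, δ, hδ, hk.mono fun n hn => (measureReal_mono ?_).trans hn⟩
        exact Set.inter_subset_inter_left _ hst
      · rintro s t ⟨k, δ, hδ, hk⟩ ⟨l, δ', hδ', hl⟩
        refine ⟨k + l, min δ δ', lt_min hδ hδ', ?_⟩
        filter_upwards [hk, hl] with n hn hn'
        rw [Set.union_inter_distrib_right, add_mul]
        refine (measureReal_union_le _ _).trans (add_le_add (le_trans ?_ hn) (le_trans ?_ hn')) <;>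
          refine measureReal_mono (Set.inter_subset_inter_right _ (Set.preimage_mono ?_))
        exacts [Metric.ball_subset_ball (min_le_left _ _), Metric.ball_subset_ball (min_le_right _ _)]
      · rintro ⟨x, s⟩ _
        by_cases hx : Φ (x, s) = y
        · have h3 : (c' : EReal) < I x + J s :=
            h2.trans_le (iInf_le_of_le x (iInf_le_of_le s (iInf_le _ hx)))
          obtain ⟨c₁, c₂, h4, h5, h6⟩ :=
            exists_real_add_eq_of_lt_add (hI.nonneg x) (hJ.nonneg s) h3
          obtain ⟨δ, hδ, hu⟩ := hI.upper x c₁ h4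
          obtain ⟨δ', hδ', hu'⟩ := hJ.upper s c₂ h5
          refine ⟨Metric.ball x δ ×ˢ Metric.ball s δ', mem_nhdsWithin_of_mem_nhds
            (prod_mem_nhds (Metric.ball_mem_nhds x hδ) (Metric.ball_mem_nhds s hδ')),
            1, 1, one_pos, ?_⟩
          filter_upwards [hu, hu'] with n hn hn'
          refine (measureReal_mono Set.inter_subset_left).trans ?_
          rw [hprod, one_mul, ← h6]
          calc _ ≤ Real.exp (-(c₁ * v n)) * Real.exp (-(c₂ * v n)) := by gcongr
            _ = _ := by rw [← Real.exp_add]; ring_nf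
        -- Points not mapped to `y` contribute nothing: balls of half the distance around the image
        -- and around `y` are disjoint, so `k = 0` works.
        · have hd : 0 < dist (Φ (x, s)) y / 2 := half_pos (dist_pos.2 hx)
          refine ⟨_, mem_nhdsWithin_of_mem_nhds
            ((Metric.isOpen_ball.preimage hΦ).mem_nhds (Metric.mem_ball_self hd)),
            0, _, hd, Eventually.of_forall fun n => ?_⟩
          rw [← Set.preimage_inter, (Metric.ball_disjoint_ball (by linarith)).inter_eq]
          simp
    obtain ⟨k, δ, hδ, hk⟩ := key
    refine ⟨δ, hδ, ?_⟩
    have hcc : c < c' := by exact_mod_cast h1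
    filter_upwards [hk, hKn, eventually_mul_exp_le hv.tendsto (k + 1) hcc] with n h3 h4 h5
    rw [hmap]
    refine le_trans ?_ h5
    calc _ ≤ ((π n).prod (μ n)).real ((K ∩ Φ ⁻¹' Metric.ball y δ) ∪ Kᶜ) := by
          refine measureReal_mono fun x hx => ?_
          by_cases hxK : x ∈ K
          exacts [Or.inl ⟨hxK, hx⟩, Or.inr hxK]
      _ ≤ _ := (measureReal_union_le _ _).trans (by rw [add_mul, one_mul]; exact add_le_add h3 h4)
  · obtain ⟨K, hK, h1⟩ := htight M
    refine ⟨Φ '' K, hK.image hΦ, h1.mono fun n hn => ?_⟩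
    rw [map_measureReal_apply hΦm (hK.image hΦ).isClosed.measurableSet.compl]
    refine (measureReal_mono ?_).trans hn
    exact fun p hp hpK => hp (Set.mem_image_of_mem _ hpK)

/-- The start of the recursion over layers, where the variance of the first layer is deterministic.
-/
lemma localLDP_dirac {v : ℕ → ℝ} (hv : IsSpeed v) (r₀ : ℝ) :
    LocalLDP (fun _ => Measure.dirac r₀) v (fun r => Delta r r₀) := by
  refine ⟨fun r => ?_, fun r c hc δ hδ => ?_, fun r c hc => ?_, fun M => ?_⟩
  · unfold Delta; split_ifs <;> simp
  · unfold Delta at hc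
    split_ifs at hc with h
    · subst h
      refine Eventually.of_forall fun n => ?_
      have hc' : 0 < c := by exact_mod_cast hc
      have hb : (Measure.dirac r).real (Metric.ball r δ) = 1 := by simp [measureReal_def, hδ]
      rw [hb, Real.exp_le_one_iff]
      have := mul_pos hc' (hv.pos n)
      linarith
    · simp at hc
  · unfold Delta at hc
    split_ifs at hc with h
    · refine ⟨1, one_pos, Eventually.of_forall fun n => measureReal_le_one.trans ?_⟩
      have hc' : c < 0 := by exact_mod_cast hc
      rw [Real.one_le_exp_iff]
      nlinarith [hv.pos n]
    · refine ⟨dist r r₀, dist_pos.2 h, Eventually.of_forall fun n => ?_⟩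
      have : (Measure.dirac r₀).real (Metric.ball r (dist r r₀)) = 0 := by
        simp [measureReal_def, dist_comm]
      rw [this]
      positivity
  · refine ⟨{r₀}, isCompact_singleton, Eventually.of_forall fun n => ?_⟩
    have : (Measure.dirac r₀).real {r₀}ᶜ = 0 := by simp [measureReal_def]
    rw [this]
    positivity

/-! ### Exponential moments and large deviations on the line -/

/-- The scaled cumulant generating functions of `π n` with speed `v n` converge at `θ` to `a`. -/
def LimCgf (π : ℕ → Measure ℝ) (v : ℕ → ℝ) (θ a : ℝ) : Prop :=
  (∀ᶠ n in atTop, Integrable (fun x => Real.exp (v n * θ * x)) (π n)) ∧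
    Tendsto (fun n => Real.log (∫ x, Real.exp (v n * θ * x) ∂(π n)) / v n) atTop (𝓝 a)

section

variable {π : ℕ → Measure ℝ} [∀ n, IsProbabilityMeasure (π n)] {v : ℕ → ℝ} {θ a : ℝ}

lemma LimCgf.eventually_le (h : LimCgf π v θ a) (hv : IsSpeed v) {a' : ℝ} (ha : a < a') :
    ∀ᶠ n in atTop, ∫ x, Real.exp (v n * θ * x) ∂(π n) ≤ Real.exp (a' * v n) := by
  filter_upwards [h.1, h.2.eventually_lt_const ha] with n h1 h2
  rw [div_lt_iff₀ (hv.pos n)] at h2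
  rw [← Real.exp_log (integral_exp_pos h1)]
  exact Real.exp_le_exp.2 h2.le

lemma LimCgf.eventually_ge (h : LimCgf π v θ a) (hv : IsSpeed v) {a' : ℝ} (ha : a' < a) :
    ∀ᶠ n in atTop, Real.exp (a' * v n) ≤ ∫ x, Real.exp (v n * θ * x) ∂(π n) := by
  filter_upwards [h.1, h.2.eventually_const_lt ha] with n h1 h2
  rw [lt_div_iff₀ (hv.pos n)] at h2
  rw [← Real.exp_log (integral_exp_pos h1)]
  exact Real.exp_le_exp.2 h2.le

lemma measureReal_le_integral {μ : Measure ℝ} [IsProbabilityMeasure μ] {A : Set ℝ}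
    (hA : MeasurableSet A) {f : ℝ → ℝ} (hf : Integrable f μ) (h0 : ∀ x, 0 ≤ f x)
    (h1 : ∀ x ∈ A, 1 ≤ f x) : μ.real A ≤ ∫ x, f x ∂μ := by
  rw [← integral_indicator_one hA]
  refine integral_mono ((integrable_const 1).indicator hA) hf fun x => ?_
  by_cases hx : x ∈ A
  · simpa [hx] using h1 x hx
  · simpa [hx] using h0 x

/-- The exponential Chebyshev inequality, in local form. -/
lemma LimCgf.ball_le (h : LimCgf π v θ a) (hv : IsSpeed v) {x c : ℝ} (hc : c < θ * x - a) :
    ∃ δ > 0, ∀ᶠ n in atTop, (π n).real (Metric.ball x δ) ≤ Real.exp (-(c * v n)) := by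
  set e := (θ * x - a - c) / 2 with he
  have he0 : 0 < e := by rw [he]; linarith
  have hθ : 0 < |θ| + 1 := by positivity
  -- On a ball of this radius θt differs from θx by at most `e`; the 1 allows θ = 0.
  refine ⟨e / (|θ| + 1), by positivity, ?_⟩
  filter_upwards [h.1, h.eventually_le hv (lt_add_of_pos_right a he0)] with n h1 h2
  have hvn := hv.pos n
  have hδ : |θ| * (e / (|θ| + 1)) ≤ e := by
    rw [mul_div_assoc', div_le_iff₀ hθ]; nlinarith
  calc (π n).real (Metric.ball x (e / (|θ| + 1)))
      ≤ ∫ t, Real.exp (-(v n * (θ * x - e))) * Real.exp (v n * θ * t) ∂(π n) := by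
        refine measureReal_le_integral Metric.isOpen_ball.measurableSet (h1.const_mul _)
          (fun t => by positivity) fun t ht => ?_
        rw [← Real.exp_add, Real.one_le_exp_iff]
        have h3 : |θ * (t - x)| ≤ e := by
          rw [abs_mul]
          refine le_trans (mul_le_mul_of_nonneg_left ?_ (abs_nonneg _)) hδ
          exact (Metric.mem_ball.1 ht).le
        have h4 := (abs_le.1 h3).1
        nlinarith
    _ = Real.exp (-(v n * (θ * x - e))) * ∫ t, Real.exp (v n * θ * t) ∂(π n) :=
        integral_const_mul _ _
    _ ≤ Real.exp (-(v n * (θ * x - e))) * Real.exp ((a + e) * v n) := by gcongr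
    _ = Real.exp (-(c * v n)) := by rw [← Real.exp_add, he]; ring_nf

/-- Chernoff bounds at `s` and `-s` control the two tails. The radius `R` is chosen so that
exp(-vsR) beats both exponential moments by the factor exp(-(M + 1) v). -/
lemma LimCgf.tight {s b : ℝ} (hs : 0 < s) (h : LimCgf π v s a) (h' : LimCgf π v (-s) b)
    (hv : IsSpeed v) (M : ℝ) :
    ∃ K : Set ℝ, IsCompact K ∧ ∀ᶠ n in atTop, (π n).real Kᶜ ≤ Real.exp (-(M * v n)) := by
  set R := (max a b + 1 + (M + 1)) / s with hR
  refine ⟨Metric.closedBall 0 R, isCompact_closedBall _ _, ?_⟩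
  have ha : a < max a b + 1 := lt_of_le_of_lt (le_max_left _ _) (lt_add_one _)
  have hb : b < max a b + 1 := lt_of_le_of_lt (le_max_right _ _) (lt_add_one _)
  filter_upwards [h.1, h'.1, h.eventually_le hv ha, h'.eventually_le hv hb,
    eventually_mul_exp_le hv.tendsto 2 (lt_add_one M)] with n h1 h2 h3 h4 h5
  refine le_trans ?_ h5
  have hvn := hv.pos n
  have hRs : s * R = max a b + 1 + (M + 1) := by rw [hR]; field_simp
  calc (π n).real (Metric.closedBall 0 R)ᶜ
      ≤ ∫ t, Real.exp (-(v n * s * R)) *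
          (Real.exp (v n * s * t) + Real.exp (v n * -s * t)) ∂(π n) := by
        refine measureReal_le_integral Metric.isClosed_closedBall.measurableSet.compl
          ((h1.add h2).const_mul _) (fun t => by positivity) fun t ht => ?_
        have ht' : R < |t| := by simpa using ht
        rw [mul_add, ← Real.exp_add, ← Real.exp_add]
        have hvs : 0 < v n * s := mul_pos hvn hs
        rcases abs_cases t with ⟨h6, _⟩ | ⟨h6, _⟩
        · have : 1 ≤ Real.exp (-(v n * s * R) + v n * s * t) := by
            rw [Real.one_le_exp_iff]; nlinarith
          have := Real.exp_pos (-(v n * s * R) + v n * -s * t)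
          linarith
        · have : 1 ≤ Real.exp (-(v n * s * R) + v n * -s * t) := by
            rw [Real.one_le_exp_iff]; nlinarith
          have := Real.exp_pos (-(v n * s * R) + v n * s * t)
          linarith
    _ = Real.exp (-(v n * s * R)) * ((∫ t, Real.exp (v n * s * t) ∂(π n)) +
          ∫ t, Real.exp (v n * -s * t) ∂(π n)) := by
        rw [integral_const_mul, integral_add h1 h2]
    _ ≤ Real.exp (-(v n * s * R)) * (Real.exp ((max a b + 1) * v n) +
          Real.exp ((max a b + 1) * v n)) := by gcongr
    _ = 2 * Real.exp (-((M + 1) * v n)) := by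
        rw [← two_mul, mul_left_comm, ← Real.exp_add, mul_assoc (v n), hRs]; ring_nf

/-- The lower bound at a point that is exposed by a derivative of the limit. -/
lemma LimCgf.le_ball {Λ : ℝ → ℝ} {x : ℝ} (h : ∀ᶠ t in 𝓝 θ, LimCgf π v t (Λ t))
    (hd : HasDerivAt Λ x θ) (hv : IsSpeed v) {c : ℝ} (hc : θ * x - Λ θ < c) {δ : ℝ} (hδ : 0 < δ) :
    ∀ᶠ n in atTop, Real.exp (-(c * v n)) ≤ (π n).real (Metric.ball x δ) := by
  set e := (c - (θ * x - Λ θ)) / 4 with he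
  have he0 : 0 < e := by rw [he]; linarith
  have hθ : 0 < |θ| + 1 := by positivity
  set d := min δ (e / (|θ| + 1)) with hd'
  have hd0 : 0 < d := lt_min hδ (by positivity)
  have hθd : |θ| * d ≤ e := by
    refine (mul_le_mul_of_nonneg_left (min_le_right _ _) (abs_nonneg _)).trans ?_
    rw [mul_div_assoc', div_le_iff₀ hθ]; nlinarith
  -- Differentiability at θ with slope `x`: for small `s`, moving θ by ±s changes `Λ` by ±sx up to
  -- sd/2. Outside the ball of radius `d`, Chebyshev's inequality gains sd, so a net gain of sd/2
  -- remains.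
  obtain ⟨s, hs, h1, h2, h3, h4⟩ : ∃ s > 0, LimCgf π v (θ + s) (Λ (θ + s)) ∧
      LimCgf π v (θ - s) (Λ (θ - s)) ∧ Λ (θ + s) ≤ Λ θ + s * x + s * (d / 2) ∧
      Λ (θ - s) ≤ Λ θ - s * x + s * (d / 2) := by
    obtain ⟨r, hr, hball⟩ := Metric.eventually_nhds_iff.1
      (h.and (hd.isLittleO.bound (half_pos hd0)))
    have ha : |r / 2| = r / 2 := abs_of_pos (half_pos hr)
    obtain ⟨h5, h6⟩ := hball (y := θ + r / 2) (by simp [abs_of_pos hr, hr])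
    obtain ⟨h7, h8⟩ := hball (y := θ - r / 2) (by simp [abs_of_pos hr, hr])
    rw [add_sub_cancel_left, Real.norm_eq_abs, Real.norm_eq_abs, ha, smul_eq_mul] at h6
    rw [show θ - r / 2 - θ = -(r / 2) by ring, Real.norm_eq_abs, Real.norm_eq_abs, abs_neg, ha,
      smul_eq_mul] at h8
    exact ⟨r / 2, half_pos hr, h5, h7, by linarith [(abs_le.1 h6).2], by linarith [(abs_le.1 h8).2]⟩
  -- The net gain is 4g; one g is given up in the upper bounds for the moments at θ ± s, which
  -- leaves 3g.
  set g := s * d / 8 with hg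
  have hg0 : 0 < g := by positivity
  have hm : 0 < min e g := lt_min he0 hg0
  have hcomp : -(Λ θ) + min e g < -(Λ θ) + 3 * g := by
    have := min_le_right e g; linarith
  have hcomp2 : θ * x - Λ θ + 2 * e < c := by rw [he]; linarith
  filter_upwards [h.self_of_nhds.1, h1.1, h2.1, h.self_of_nhds.eventually_ge hv (sub_lt_self _ hm),
    h1.eventually_le hv (lt_add_of_pos_right _ hg0), h2.eventually_le hv (lt_add_of_pos_right _ hg0),
    eventually_mul_exp_le hv.tendsto 4 hcomp, eventually_mul_exp_le hv.tendsto 2 hcomp2]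
    with n i0 i1 i2 m0 m1 m2 k1 k2
  have hvn := hv.pos n
  have hB : MeasurableSet (Metric.ball x d) := Metric.isOpen_ball.measurableSet
  -- This replaces the usual change of measure: the moment at θ is split into the part from the ball
  -- and the parts to its right and left, the latter two bounded through the moments at θ + s and θ
  -- - s.
  have main : ∫ t, Real.exp (v n * θ * t) ∂(π n) ≤
      (π n).real (Metric.ball x d) * Real.exp (v n * (θ * x + e)) +
      Real.exp (-(v n * s * (x + d))) * ∫ t, Real.exp (v n * (θ + s) * t) ∂(π n) +
      Real.exp (v n * s * (x - d)) * ∫ t, Real.exp (v n * (θ - s) * t) ∂(π n) := by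
    have j0 : Integrable (fun t => (Metric.ball x d).indicator 1 t * Real.exp (v n * (θ * x + e)))
        (π n) := ((integrable_const 1).indicator hB).mul_const _
    have j3 : Integrable (fun t => (Metric.ball x d).indicator 1 t * Real.exp (v n * (θ * x + e)) +
        Real.exp (-(v n * s * (x + d))) * Real.exp (v n * (θ + s) * t)) (π n) :=
      j0.add (i1.const_mul _)
    rw [← integral_indicator_one hB, ← integral_const_mul, ← integral_const_mul,
      ← integral_mul_const, ← integral_add j0 (i1.const_mul _),
      ← integral_add j3 (i2.const_mul _)]
    refine integral_mono i0 (j3.add (i2.const_mul _)) fun t => ?_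
    simp only [← Real.exp_add]
    have p1 := Real.exp_pos (-(v n * s * (x + d)) + v n * (θ + s) * t)
    have p2 := Real.exp_pos (v n * s * (x - d) + v n * (θ - s) * t)
    have hvs : 0 < v n * s := mul_pos hvn hs
    by_cases ht : t ∈ Metric.ball x d
    · have h3 : |θ * (t - x)| ≤ e := by
        rw [abs_mul]
        exact le_trans (mul_le_mul_of_nonneg_left (Metric.mem_ball.1 ht).le (abs_nonneg _)) hθd
      have h4 := (abs_le.1 h3).2
      have : Real.exp (v n * θ * t) ≤ Real.exp (v n * (θ * x + e)) := by
        rw [Real.exp_le_exp]; nlinarith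
      simp only [ht, Set.indicator_of_mem, Pi.one_apply, one_mul]
      linarith
    · simp only [ht, not_false_eq_true, Set.indicator_of_notMem, zero_mul, zero_add]
      rw [Metric.mem_ball, not_lt, Real.dist_eq] at ht
      rcases abs_cases (t - x) with ⟨h6, _⟩ | ⟨h6, _⟩
      · have : Real.exp (v n * θ * t) ≤ Real.exp (-(v n * s * (x + d)) + v n * (θ + s) * t) := by
          rw [Real.exp_le_exp]; nlinarith
        linarith
      · have : Real.exp (v n * θ * t) ≤ Real.exp (v n * s * (x - d) + v n * (θ - s) * t) := by
          rw [Real.exp_le_exp]; nlinarith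
        linarith
  have t1 : Real.exp (-(v n * s * (x + d))) * ∫ t, Real.exp (v n * (θ + s) * t) ∂(π n) ≤
      Real.exp (-((-(Λ θ) + 3 * g) * v n)) := by
    refine (mul_le_mul_of_nonneg_left m1 (Real.exp_pos _).le).trans ?_
    rw [← Real.exp_add, Real.exp_le_exp]
    nlinarith
  have t2 : Real.exp (v n * s * (x - d)) * ∫ t, Real.exp (v n * (θ - s) * t) ∂(π n) ≤
      Real.exp (-((-(Λ θ) + 3 * g) * v n)) := by
    refine (mul_le_mul_of_nonneg_left m2 (Real.exp_pos _).le).trans ?_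
    rw [← Real.exp_add, Real.exp_le_exp]
    nlinarith
  have k1' : 4 * Real.exp (-((-(Λ θ) + 3 * g) * v n)) ≤ Real.exp ((Λ θ - min e g) * v n) := by
    convert k1 using 2; ring
  have m3 : Real.exp ((Λ θ - e) * v n) ≤ Real.exp ((Λ θ - min e g) * v n) := by
    rw [Real.exp_le_exp]
    have := min_le_left e g
    nlinarith
  -- Each side term is at most a quarter of the lower bound for the whole moment, so the ball
  -- accounts for at least half of that bound.
  have fin : Real.exp ((Λ θ - e) * v n) ≤
      2 * ((π n).real (Metric.ball x d) * Real.exp (v n * (θ * x + e))) := by linarith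
  calc Real.exp (-(c * v n)) ≤ Real.exp (-((θ * x - Λ θ + 2 * e) * v n)) / 2 := by
        rw [le_div_iff₀ two_pos, mul_comm]; exact k2
    _ = Real.exp ((Λ θ - e) * v n) * Real.exp (-(v n * (θ * x + e))) / 2 := by
        rw [← Real.exp_add]; ring_nf
    _ ≤ 2 * ((π n).real (Metric.ball x d) * Real.exp (v n * (θ * x + e))) *
          Real.exp (-(v n * (θ * x + e))) / 2 := by gcongr
    _ = (π n).real (Metric.ball x d) := by
        rw [Real.exp_neg]; field_simp
    _ ≤ (π n).real (Metric.ball x δ) := measureReal_mono (Metric.ball_subset_ball (min_le_left _ _))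

end

/-- Finite products, with rate functions that are finite everywhere. -/
lemma LocalLDP.pi {m : ℕ} {π : ℕ → Measure ℝ} [∀ n, IsProbabilityMeasure (π n)] {v : ℕ → ℝ}
    {I : ℝ → ℝ} (h : LocalLDP π v (fun x => (I x : EReal))) (hv : IsSpeed v) :
    LocalLDP (fun n => Measure.pi fun _ : Fin m => π n) v (fun x => ((∑ i, I (x i) : ℝ) : EReal)) := by
  have hI : ∀ x, 0 ≤ I x := fun x => by exact_mod_cast h.nonneg x
  have hball : ∀ (n : ℕ) (x : Fin m → ℝ) (δ : ℝ), 0 < δ →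
      (Measure.pi fun _ : Fin m => π n).real (Metric.ball x δ) =
        ∏ i, (π n).real (Metric.ball (x i) δ) := by
    intro n x δ hδ
    rw [ball_pi x hδ, measureReal_def, Measure.pi_pi, ENNReal.toReal_prod]
    rfl
  have hsum : ∀ (c : Fin m → ℝ) (n : ℕ), ∏ i, Real.exp (-(c i * v n)) =
      Real.exp (-((∑ i, c i) * v n)) := by
    intro c n
    rw [← Real.exp_sum, Finset.sum_neg_distrib, Finset.sum_mul]
  refine ⟨fun x => ?_, fun x c hc δ hδ => ?_, fun x c hc => ?_, fun M => ?_⟩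
  · exact_mod_cast Finset.sum_nonneg fun i _ => hI (x i)
  · have hc' : ∑ i, I (x i) < c := by exact_mod_cast hc
    -- The slack is shared among the coordinates; dividing by m + 1 rather than m also covers m = 0.
    set e := (c - ∑ i, I (x i)) / (m + 1) with he
    have hm : (0 : ℝ) < m + 1 := by positivity
    have he0 : 0 < e := div_pos (by linarith) hm
    have hs : ∑ i, (I (x i) + e) ≤ c := by
      rw [Finset.sum_add_distrib, Finset.sum_const, Finset.card_univ, Fintype.card_fin, nsmul_eq_mul]
      have : (m + 1) * e = c - ∑ i, I (x i) := by rw [he]; field_simp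
      linarith
    have := eventually_all.2 fun i => h.lower (x i) (I (x i) + e)
      (by exact_mod_cast lt_add_of_pos_right _ he0) δ hδ
    filter_upwards [this] with n hn
    rw [hball n x δ hδ]
    calc Real.exp (-(c * v n)) ≤ Real.exp (-((∑ i, (I (x i) + e)) * v n)) :=
          (exp_neg_mul_le_iff (hv.pos n)).2 hs
      _ = ∏ i, Real.exp (-((I (x i) + e) * v n)) := (hsum _ n).symm
      _ ≤ _ := Finset.prod_le_prod (fun i _ => (Real.exp_pos _).le) fun i _ => hn i
  · have hc' : c < ∑ i, I (x i) := by exact_mod_cast hc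
    set e := (∑ i, I (x i) - c) / (m + 1) with he
    have hm : (0 : ℝ) < m + 1 := by positivity
    have he0 : 0 < e := div_pos (by linarith) hm
    have hs : c ≤ ∑ i, (I (x i) - e) := by
      rw [Finset.sum_sub_distrib, Finset.sum_const, Finset.card_univ, Fintype.card_fin, nsmul_eq_mul]
      have : (m + 1) * e = ∑ i, I (x i) - c := by rw [he]; field_simp
      linarith
    have := fun i => h.upper (x i) (I (x i) - e) (by exact_mod_cast sub_lt_self _ he0)
    choose δ hδ hu using this
    -- All small positive radii qualify, which gives a common one even for m = 0, where there is no
    -- minimum to take.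
    obtain ⟨d, hd, hdδ⟩ : ∃ d > 0, ∀ i, d ≤ δ i := by
      have : ∀ᶠ d in 𝓝[>] (0 : ℝ), ∀ i, d ≤ δ i := eventually_all.2 fun i =>
        (eventually_le_nhds (hδ i)).filter_mono nhdsWithin_le_nhds
      obtain ⟨d, h1, h2⟩ := (this.and self_mem_nhdsWithin).exists
      exact ⟨d, h2, h1⟩
    refine ⟨d, hd, ?_⟩
    filter_upwards [eventually_all.2 hu] with n hn
    rw [hball n x d hd]
    calc _ ≤ ∏ i, Real.exp (-((I (x i) - e) * v n)) :=
          Finset.prod_le_prod (fun i _ => measureReal_nonneg) fun i _ =>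
            (measureReal_mono (Metric.ball_subset_ball (hdδ i))).trans (hn i)
      _ = Real.exp (-((∑ i, (I (x i) - e)) * v n)) := hsum _ n
      _ ≤ _ := (exp_neg_mul_le_iff (hv.pos n)).2 hs
  · obtain ⟨K, hK, hKn⟩ := h.tight (M + 1)
    refine ⟨Set.univ.pi fun _ => K, isCompact_univ_pi fun _ => hK, ?_⟩
    filter_upwards [hKn, eventually_mul_exp_le hv.tendsto m (lt_add_one M)] with n h1 h2
    refine le_trans ?_ h2
    calc _ ≤ (Measure.pi fun _ : Fin m => π n).real (⋃ i, Function.eval i ⁻¹' Kᶜ) := by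
          refine measureReal_mono fun x hx => ?_
          simpa [Set.mem_pi] using hx
      _ ≤ ∑ i : Fin m, (Measure.pi fun _ : Fin m => π n).real (Function.eval i ⁻¹' Kᶜ) :=
          measureReal_iUnion_fintype_le _
      _ = ∑ i : Fin m, (π n).real Kᶜ := by
          refine Finset.sum_congr rfl fun i _ => ?_
          have := measurePreserving_eval (fun _ : Fin m => π n) i
          exact this.measureReal_preimage hK.isClosed.measurableSet.compl.nullMeasurableSet
      _ ≤ ∑ _i : Fin m, Real.exp (-((M + 1) * v n)) := Finset.sum_le_sum fun i _ => h1
      _ = _ := by simp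

/-! ### Exponential moments of the squared ReLU of a Gaussian variable -/

/-- Positive homogeneity takes the variance out of the square, which reduces all questions to q = 1.
The maximum with 0 reflects that `√q` is 0 for negative `q`. -/
lemma relu_sq_mul_sqrt (q t : ℝ) : relu (√q * t) ^ 2 = max q 0 * relu t ^ 2 := by
  unfold relu
  have : max (√q * t) 0 = √q * max t 0 := by
    rw [mul_max_of_nonneg _ _ (Real.sqrt_nonneg q), mul_zero]
  rw [this, mul_pow]
  rcases le_total 0 q with h | h
  · rw [Real.sq_sqrt h, max_eq_left h]
  · rw [Real.sqrt_eq_zero_of_nonpos h, max_eq_right h]; ring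

lemma continuous_relu : Continuous relu := continuous_id.max continuous_const

lemma measurable_relu : Measurable relu := continuous_relu.measurable

/-- `(1 - 2c)^{-1/2}`. -/
noncomputable def invSqrt (c : ℝ) : ℝ := (1 - 2 * c) ^ (-(1 / 2) : ℝ)

/-- The logarithmic moment generating function of the squared ReLU of a standard normal variable,
where it is finite. -/
noncomputable def logMgf (c : ℝ) : ℝ := Real.log ((invSqrt c + 1) / 2)

lemma invSqrt_pos {c : ℝ} (hc : c < 1 / 2) : 0 < invSqrt c :=
  Real.rpow_pos_of_pos (by linarith) _

lemma invSqrt_eq {c : ℝ} (hc : c < 1 / 2) : invSqrt c = (√(1 - 2 * c))⁻¹ := by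
  rw [invSqrt, Real.rpow_neg (by linarith), Real.sqrt_eq_rpow]

lemma setLIntegral_Ioi_gaussian {c : ℝ} (hc : c < 1 / 2) :
    ∫⁻ t in Set.Ioi 0, ENNReal.ofReal (Real.exp (c * t ^ 2)) ∂(gaussianReal 0 1) =
      ENNReal.ofReal (invSqrt c / 2) := by
  have hb : 0 < 1 / 2 - c := by linarith
  rw [gaussianReal_of_var_ne_zero _ one_ne_zero,
    setLIntegral_withDensity_eq_setLIntegral_mul _ (measurable_gaussianPDF 0 1) (by fun_prop)
      measurableSet_Ioi]
  have h1 : ∀ t : ℝ, (gaussianPDF 0 1 * fun t => ENNReal.ofReal (Real.exp (c * t ^ 2))) t =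
      ENNReal.ofReal ((√(2 * Real.pi))⁻¹ * Real.exp (-(1 / 2 - c) * t ^ 2)) := by
    intro t
    rw [Pi.mul_apply, gaussianPDF, ← ENNReal.ofReal_mul (gaussianPDFReal_nonneg _ _ _),
      gaussianPDFReal, mul_assoc, ← Real.exp_add]
    congr 2
    · simp
    · congr 1; simp; ring
  simp_rw [h1]
  rw [← ofReal_integral_eq_lintegral_ofReal
    ((integrable_exp_neg_mul_sq hb).integrableOn.const_mul _)
    (ae_of_all _ fun t => by positivity), integral_const_mul, integral_gaussian_Ioi, invSqrt_eq hc]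
  congr 1
  have h2 : Real.pi / (1 / 2 - c) = (2 * Real.pi) / (1 - 2 * c) := by
    have : 1 - 2 * c ≠ 0 := by linarith
    have : 1 / 2 - c ≠ 0 := by linarith
    field_simp
  rw [h2, Real.sqrt_div (by positivity)]
  have : √(2 * Real.pi) ≠ 0 := by positivity
  have h3 : √(1 - 2 * c) ≠ 0 := (Real.sqrt_pos.2 (by linarith)).ne'
  field_simp

lemma gaussianReal_Ioi : gaussianReal 0 1 (Set.Ioi 0) = ENNReal.ofReal (1 / 2) := by
  have := setLIntegral_Ioi_gaussian (c := 0) (by norm_num)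
  simpa [invSqrt] using this

lemma gaussianReal_Iic : gaussianReal 0 1 (Set.Iic 0) = ENNReal.ofReal (1 / 2) := by
  rw [← Set.compl_Ioi, prob_compl_eq_one_sub measurableSet_Ioi, gaussianReal_Ioi,
    ← ENNReal.ofReal_one, ← ENNReal.ofReal_sub _ (by norm_num)]
  norm_num

/-- ReLU vanishes on the negative half-line, so half of the Gaussian mass contributes the integrand
1. This is the origin of the summand 1 in (w + 1)/2. -/
lemma lintegral_exp_relu_sq (c : ℝ) :
    ∫⁻ t, ENNReal.ofReal (Real.exp (c * relu t ^ 2)) ∂(gaussianReal 0 1) =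
      ENNReal.ofReal (1 / 2) +
        ∫⁻ t in Set.Ioi 0, ENNReal.ofReal (Real.exp (c * t ^ 2)) ∂(gaussianReal 0 1) := by
  rw [← lintegral_add_compl _ (measurableSet_Iic (a := (0 : ℝ))), Set.compl_Iic,
    ← gaussianReal_Iic, ← setLIntegral_one]
  congr 1
  · refine setLIntegral_congr_fun measurableSet_Iic fun t ht => ?_
    simp [relu, max_eq_right (Set.mem_Iic.1 ht)]
  · refine setLIntegral_congr_fun measurableSet_Ioi fun t ht => ?_
    simp [relu, max_eq_left (le_of_lt (Set.mem_Ioi.1 ht))]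

lemma lintegral_exp_relu_sq_of_lt {c : ℝ} (hc : c < 1 / 2) :
    ∫⁻ t, ENNReal.ofReal (Real.exp (c * relu t ^ 2)) ∂(gaussianReal 0 1) =
      ENNReal.ofReal ((invSqrt c + 1) / 2) := by
  rw [lintegral_exp_relu_sq, setLIntegral_Ioi_gaussian hc,
    ← ENNReal.ofReal_add (by norm_num) (by have := invSqrt_pos hc; positivity)]
  congr 1; ring

/-- For c ≥ 1/2 the exponential compensates the Gaussian decay, and the integrand with its density
is bounded below by a positive constant on a half-line. -/
lemma lintegral_exp_relu_sq_of_ge {c : ℝ} (hc : 1 / 2 ≤ c) :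
    ∫⁻ t, ENNReal.ofReal (Real.exp (c * relu t ^ 2)) ∂(gaussianReal 0 1) = ⊤ := by
  rw [lintegral_exp_relu_sq, gaussianReal_of_var_ne_zero _ one_ne_zero,
    setLIntegral_withDensity_eq_setLIntegral_mul _ (measurable_gaussianPDF 0 1) (by fun_prop)
      measurableSet_Ioi]
  have h1 : ∫⁻ _ in Set.Ioi (0 : ℝ), ENNReal.ofReal (√(2 * Real.pi))⁻¹ = ⊤ := by
    rw [setLIntegral_const, Real.volume_Ioi, ENNReal.mul_top]
    simp only [ne_eq, ENNReal.ofReal_eq_zero, not_le]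
    positivity
  rw [ENNReal.add_eq_top, ← top_le_iff (a := lintegral _ _), ← h1]
  refine Or.inr (lintegral_mono fun t => ?_)
  rw [Pi.mul_apply, gaussianPDF, ← ENNReal.ofReal_mul (gaussianPDFReal_nonneg _ _ _),
    gaussianPDFReal, mul_assoc, ← Real.exp_add]
  refine ENNReal.ofReal_le_ofReal ?_
  have : 1 ≤ Real.exp (-(t - 0) ^ 2 / (2 * ((1 : ℝ≥0) : ℝ)) + c * t ^ 2) := by
    rw [Real.one_le_exp_iff]
    simp only [NNReal.coe_one, sub_zero, mul_one]
    nlinarith [sq_nonneg t]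
  calc (√(2 * Real.pi))⁻¹ = (√(2 * Real.pi))⁻¹ * 1 := (mul_one _).symm
    _ ≤ _ := by
      rw [NNReal.coe_one, mul_one (2 * Real.pi)]
      exact mul_le_mul_of_nonneg_left (by simpa using this) (by positivity)

lemma integrable_exp_relu_sq {c : ℝ} (hc : c < 1 / 2) :
    Integrable (fun t => Real.exp (c * relu t ^ 2)) (gaussianReal 0 1) := by
  have hm := measurable_relu
  refine ⟨by fun_prop, ?_⟩
  rw [hasFiniteIntegral_iff_ofReal (ae_of_all _ fun t => (Real.exp_pos _).le),
    lintegral_exp_relu_sq_of_lt hc]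
  exact ENNReal.ofReal_lt_top

lemma integral_exp_relu_sq {c : ℝ} (hc : c < 1 / 2) :
    ∫ t, Real.exp (c * relu t ^ 2) ∂(gaussianReal 0 1) = (invSqrt c + 1) / 2 := by
  have := invSqrt_pos hc
  rw [integral_eq_lintegral_of_nonneg_ae (ae_of_all _ fun t => (Real.exp_pos _).le)
    (integrable_exp_relu_sq hc).1, lintegral_exp_relu_sq_of_lt hc,
    ENNReal.toReal_ofReal (by positivity)]

/-- By symmetry, relu(t)² and relu(-t)² have the same mean, and they add up to t². -/
lemma meanSq_relu (q : ℝ) : meanSq relu q = max q 0 / 2 := by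
  have hm := measurable_relu
  have h2 : ∫ t, t ^ 2 ∂(gaussianReal 0 1) = 1 := by
    have := variance_of_integral_eq_zero (μ := gaussianReal 0 1) (X := id) (by fun_prop) (by simp)
    simpa [variance_id_gaussianReal] using this.symm
  have hint : Integrable (fun t : ℝ => t ^ 2) (gaussianReal 0 1) :=
    (memLp_id_gaussianReal 2).integrable_sq
  have hr : Integrable (fun t => relu t ^ 2) (gaussianReal 0 1) := by
    refine hint.mono' (by fun_prop) (ae_of_all _ fun t => ?_)
    rw [Real.norm_eq_abs, abs_of_nonneg (sq_nonneg _), relu]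
    rcases le_total t 0 with h | h
    · rw [max_eq_right h]; nlinarith [sq_nonneg t]
    · rw [max_eq_left h]
  have hmap : (gaussianReal 0 1).map (fun x : ℝ => -x) = gaussianReal 0 1 := by
    simpa using gaussianReal_map_neg (μ := 0) (v := 1)
  have hr' : Integrable (fun t => relu (-t) ^ 2) (gaussianReal 0 1) := by
    have : Integrable (fun t => relu t ^ 2) ((gaussianReal 0 1).map (fun x : ℝ => -x)) := by
      rwa [hmap]
    exact this.comp_measurable measurable_neg
  have hsymm : ∫ t, relu (-t) ^ 2 ∂(gaussianReal 0 1) = ∫ t, relu t ^ 2 ∂(gaussianReal 0 1) := by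
    conv_rhs => rw [← hmap]
    rw [integral_map (by fun_prop) (by fun_prop)]
  have hsum : ∫ t, relu t ^ 2 ∂(gaussianReal 0 1) + ∫ t, relu (-t) ^ 2 ∂(gaussianReal 0 1) = 1 := by
    rw [← integral_add hr hr', ← h2]
    congr 1
    ext t
    unfold relu
    rcases le_total t 0 with h | h
    · rw [max_eq_right h, max_eq_left (by linarith)]; ring
    · rw [max_eq_left h, max_eq_right (by linarith)]; ring
  unfold meanSq
  simp_rw [relu_sq_mul_sqrt, integral_const_mul]
  rw [hsymm] at hsum
  rw [show ∫ t, relu t ^ 2 ∂(gaussianReal 0 1) = 1 / 2 by linarith]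
  ring

/-! ### The function `κ` -/

lemma kappa_relu_of_nonneg {q : ℝ} (hq : 0 ≤ q) (η : ℝ) :
    kappa relu η q = kappa relu (η * q) 1 := by
  unfold kappa
  simp_rw [relu_sq_mul_sqrt, max_eq_left hq, max_eq_left zero_le_one, one_mul, mul_assoc]

lemma kappa_relu_of_nonpos {q : ℝ} (hq : q ≤ 0) (η : ℝ) : kappa relu η q = 0 := by
  unfold kappa
  simp_rw [relu_sq_mul_sqrt, max_eq_right hq]
  simp

lemma kappa_relu_one_of_lt {c : ℝ} (hc : c < 1 / 2) :
    kappa relu c 1 = ((logMgf c : ℝ) : EReal) := by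
  have := invSqrt_pos hc
  unfold kappa
  simp_rw [Real.sqrt_one, one_mul]
  rw [lintegral_exp_relu_sq_of_lt hc, ENNReal.log_ofReal_of_pos (by positivity)]
  rfl

lemma kappa_relu_one_of_ge {c : ℝ} (hc : 1 / 2 ≤ c) : kappa relu c 1 = ⊤ := by
  unfold kappa
  simp_rw [Real.sqrt_one, one_mul]
  rw [lintegral_exp_relu_sq_of_ge hc, ENNReal.log_top]

lemma lt_one_div_iff {q : ℝ} (hq : 0 < q) (η : ℝ) : η < 1 / (2 * q) ↔ η * q < 1 / 2 := by
  rw [lt_div_iff₀ (by positivity)]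
  constructor <;> intro h <;> linarith

lemma kappa_relu_of_lt {q η : ℝ} (hq : 0 < q) (h : η < 1 / (2 * q)) :
    kappa relu η q = ((logMgf (η * q) : ℝ) : EReal) := by
  rw [kappa_relu_of_nonneg hq.le, kappa_relu_one_of_lt ((lt_one_div_iff hq η).1 h)]

lemma kappa_relu_of_ge {q η : ℝ} (hq : 0 < q) (h : 1 / (2 * q) ≤ η) : kappa relu η q = ⊤ := by
  rw [kappa_relu_of_nonneg hq.le, kappa_relu_one_of_ge]
  rw [← not_lt, lt_one_div_iff hq, not_lt] at h
  exact h

/-! ### The function z³/(z + 1) and the derivative of κ -/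

lemma cubicRatio_pos {z : ℝ} (hz : 0 < z) : 0 < cubicRatio z := by
  unfold cubicRatio; positivity

lemma cubicRatio_strictMonoOn : StrictMonoOn cubicRatio (Set.Ioi 0) := by
  intro a ha b hb hab
  have ha' : 0 < a := ha
  have hb' : 0 < b := hb
  unfold cubicRatio
  rw [div_lt_div_iff₀ (by linarith) (by linarith)]
  have h3 : a ^ 3 < b ^ 3 := by gcongr
  have h2 : a ^ 2 < b ^ 2 := by gcongr
  nlinarith [mul_pos ha' hb']

lemma cubicRatio_bijOn : Set.BijOn cubicRatio (Set.Ioi 0) (Set.Ioi 0) := by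
  refine ⟨fun z hz => cubicRatio_pos hz, cubicRatio_strictMonoOn.injOn, fun y hy => ?_⟩
  have hy' : 0 < y := hy
  have hcont : ContinuousOn cubicRatio (Set.Icc (min 1 y) (1 + y)) := by
    unfold cubicRatio
    refine ContinuousOn.div (by fun_prop) (by fun_prop) fun z hz => ?_
    have : 0 < min 1 y := lt_min one_pos hy'
    have := hz.1
    linarith
  -- Bracket for the intermediate value theorem: f(z) ≤ z ≤ y at z = min 1 y, because z³ ≤ z there,
  -- while f(1 + y) ≥ y.
  have hle : min 1 y ≤ 1 + y := (min_le_left _ _).trans (by linarith)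
  have h1 : cubicRatio (min 1 y) ≤ y := by
    set z := min 1 y with hz
    have h0 : 0 < z := lt_min one_pos hy'
    have h1 : z ≤ 1 := min_le_left _ _
    have h2 : z ≤ y := min_le_right _ _
    unfold cubicRatio
    rw [div_le_iff₀ (by linarith)]
    nlinarith [mul_pos h0 h0, mul_pos h0 hy']
  have h2 : y ≤ cubicRatio (1 + y) := by
    unfold cubicRatio
    rw [le_div_iff₀ (by linarith)]
    nlinarith [mul_pos hy' hy', mul_pos (mul_pos hy' hy') hy']
  obtain ⟨z, hz, hzy⟩ := intermediate_value_Icc hle hcont ⟨h1, h2⟩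
  exact ⟨z, lt_of_lt_of_le (lt_min one_pos hy') hz.1, hzy⟩

lemma cubicRatioInv_pos {y : ℝ} (hy : 0 < y) : 0 < cubicRatioInv y :=
  Function.invFunOn_mem (cubicRatio_bijOn.surjOn hy)

lemma cubicRatio_cubicRatioInv {y : ℝ} (hy : 0 < y) : cubicRatio (cubicRatioInv y) = y :=
  Function.invFunOn_eq (cubicRatio_bijOn.surjOn hy)

/-- The function w = (1 - 2c)^(-1/2) solves w' = w³, hence log((w + 1)/2) has derivative w³/(w + 1).
-/
lemma hasDerivAt_logMgf {c : ℝ} (hc : c < 1 / 2) :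
    HasDerivAt logMgf (cubicRatio (invSqrt c)) c := by
  have hw := invSqrt_pos hc
  have h1 : HasDerivAt invSqrt (invSqrt c ^ 3) c := by
    have h2 : HasDerivAt (fun c : ℝ => 1 - 2 * c) (-2) c := by
      simpa using ((hasDerivAt_id c).const_mul 2).const_sub 1
    have h3 := h2.rpow_const (p := (-(1 / 2) : ℝ)) (Or.inl (by linarith))
    refine HasDerivAt.congr_deriv h3 ?_
    unfold invSqrt
    rw [← Real.rpow_natCast, ← Real.rpow_mul (by linarith)]
    norm_num
  have h4 : HasDerivAt logMgf _ c := ((h1.add_const 1).div_const 2).log (by positivity)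
  refine h4.congr_deriv ?_
  unfold cubicRatio
  field_simp

lemma invSqrt_strictMonoOn : StrictMonoOn invSqrt (Set.Iio (1 / 2)) := by
  intro a ha b hb hab
  have hb' : b < 1 / 2 := hb
  exact Real.rpow_lt_rpow_of_neg (by linarith) (by linarith) (by norm_num)

/-- The derivative is a composition of two increasing functions. -/
lemma convexOn_logMgf : ConvexOn ℝ (Set.Iio (1 / 2)) logMgf := by
  refine MonotoneOn.convexOn_of_deriv (convex_Iio _)
    (fun c hc => (hasDerivAt_logMgf hc).continuousAt.continuousWithinAt)
    (fun c hc => ?_) ?_ <;> rw [interior_Iio] at *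
  · exact (hasDerivAt_logMgf hc).differentiableAt.differentiableWithinAt
  · intro a ha b hb hab
    rw [(hasDerivAt_logMgf ha).deriv, (hasDerivAt_logMgf hb).deriv]
    exact cubicRatio_strictMonoOn.monotoneOn (invSqrt_pos ha) (invSqrt_pos hb)
      (invSqrt_strictMonoOn.monotoneOn ha hb hab)

/-- A convex function lies above its tangents; this is the upper bound for the Legendre transform at
a slope of `logMgf`. -/
lemma logMgf_tangent {c d : ℝ} (hc : c < 1 / 2) (hd : d < 1 / 2) :
    logMgf c + cubicRatio (invSqrt c) * (d - c) ≤ logMgf d := by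
  rcases lt_trichotomy c d with h | rfl | h
  · have := convexOn_logMgf.le_slope_of_hasDerivAt hc hd h (hasDerivAt_logMgf hc)
    rw [slope_def_field, le_div_iff₀ (by linarith)] at this
    linarith
  · simp
  · have := convexOn_logMgf.slope_le_of_hasDerivAt hd hc h (hasDerivAt_logMgf hc)
    rw [slope_def_field, div_le_iff₀ (by linarith)] at this
    linarith

lemma tendsto_invSqrt : Tendsto invSqrt (𝓝[<] (1 / 2)) atTop := by
  have h1 : Tendsto (fun c : ℝ => 1 - 2 * c) (𝓝[<] (1 / 2)) (𝓝[>] 0) := by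
    refine tendsto_nhdsWithin_iff.2 ⟨?_, ?_⟩
    · have : ContinuousAt (fun c : ℝ => 1 - 2 * c) (1 / 2) := by fun_prop
      have h := this.tendsto
      norm_num at h
      exact h.mono_left (by norm_num; exact nhdsWithin_le_nhds)
    · filter_upwards [self_mem_nhdsWithin] with c hc
      have : c < 1 / 2 := hc
      simp only [Set.mem_Ioi]; linarith
  have h2 := tendsto_inv_nhdsGT_zero.comp
    ((tendsto_nhdsWithin_iff.2 ⟨(Real.continuous_sqrt.tendsto' 0 0 Real.sqrt_zero).mono_left
      nhdsWithin_le_nhds, by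
        filter_upwards [self_mem_nhdsWithin] with c hc using Real.sqrt_pos.2 hc⟩ :
      Tendsto Real.sqrt (𝓝[>] 0) (𝓝[>] 0)).comp h1)
  refine h2.congr' ?_
  filter_upwards [self_mem_nhdsWithin] with c hc
  exact (invSqrt_eq hc).symm

lemma tendsto_logMgf : Tendsto logMgf (𝓝[<] (1 / 2)) atTop :=
  Real.tendsto_log_atTop.comp
    ((tendsto_atTop_add_const_right _ 1 tendsto_invSqrt).atTop_div_const two_pos)

/-- Only c = 1/2 is delicate: κ is infinite there, and its finite values blow up as c tends to 1/2
from the left. -/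
lemma lowerSemicontinuous_kappa_one : LowerSemicontinuous fun c => kappa relu c 1 := by
  intro c y hy
  by_cases hc : c < 1 / 2
  · have hcont : ContinuousAt (fun c => ((logMgf c : ℝ) : EReal)) c :=
      continuous_coe_real_ereal.continuousAt.comp (hasDerivAt_logMgf hc).continuousAt
    simp only [kappa_relu_one_of_lt hc] at hy
    filter_upwards [hcont.eventually_const_lt hy, eventually_lt_nhds hc] with d h1 h2
    rwa [kappa_relu_one_of_lt h2]
  · have hc := not_lt.1 hc
    simp only [kappa_relu_one_of_ge hc] at hy
    obtain ⟨r, hyr, -⟩ := EReal.lt_iff_exists_real_btwn.1 hy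
    have key : ∀ᶠ d in 𝓝 c, d < 1 / 2 → r < logMgf d := by
      rcases hc.eq_or_lt with h | h
      · rw [← h]
        exact eventually_nhdsWithin_iff.1 (tendsto_logMgf.eventually_gt_atTop r)
      · filter_upwards [eventually_gt_nhds h] with d hd hd'
        exact absurd hd hd'.not_gt
    filter_upwards [key] with d hd
    by_cases h : d < 1 / 2
    · rw [kappa_relu_one_of_lt h]
      exact hyr.trans (EReal.coe_lt_coe_iff.2 (hd h))
    · rw [kappa_relu_one_of_ge (not_lt.1 h)]
      exact hy

lemma lowerSemicontinuous_kappa {q : ℝ} (hq : 0 ≤ q) :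
    LowerSemicontinuous fun η => kappa relu η q := by
  simp_rw [kappa_relu_of_nonneg hq]
  exact lowerSemicontinuous_kappa_one.comp (continuous_mul_const q)

lemma kappa_toReal_eventuallyEq {q η : ℝ} (hq : 0 < q) (h : η < 1 / (2 * q)) :
    (fun t => (kappa relu t q).toReal) =ᶠ[𝓝 η] fun t => logMgf (t * q) := by
  filter_upwards [eventually_lt_nhds h] with t ht
  rw [kappa_relu_of_lt hq ht, EReal.toReal_coe]

lemma hasDerivAt_kappa {q η : ℝ} (hq : 0 < q) (h : η < 1 / (2 * q)) :
    HasDerivAt (fun t => (kappa relu t q).toReal) (q * cubicRatio (invSqrt (η * q))) η := by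
  refine HasDerivAt.congr_of_eventuallyEq ?_ (kappa_toReal_eventuallyEq hq h)
  have h1 := hasDerivAt_logMgf ((lt_one_div_iff hq η).1 h)
  have h2 : HasDerivAt (fun t : ℝ => t * q) q η := by simpa using (hasDerivAt_id η).mul_const q
  rw [mul_comm]
  exact HasDerivAt.comp (h₂ := logMgf) η h1 h2

lemma cubicRatio_invSqrt_eq {q η : ℝ} (hq : 0 < q) (h : η < 1 / (2 * q)) :
    q * cubicRatio (invSqrt (η * q)) =
      q * (1 - 2 * η * q) ^ (-(3 / 2) : ℝ) / ((1 - 2 * η * q) ^ (-(1 / 2) : ℝ) + 1) := by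
  have h1 := (lt_one_div_iff hq η).1 h
  rw [cubicRatio, invSqrt, mul_div_assoc, ← Real.rpow_natCast, ← Real.rpow_mul (by linarith),
    mul_assoc 2 η q]
  norm_num

lemma tendsto_cubicRatio : Tendsto cubicRatio atTop atTop := by
  refine tendsto_atTop_mono' _ ?_ (tendsto_atTop_add_const_right _ (-1) tendsto_id)
  filter_upwards [eventually_gt_atTop 0] with z hz
  unfold cubicRatio
  rw [le_div_iff₀ (by linarith), id]
  nlinarith [pow_pos hz 3, sq_nonneg (z - 1), sq_nonneg z]

lemma effDomain_kappa {q : ℝ} (hq : 0 < q) :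
    effDomain (fun η => kappa relu η q) = Set.Iio (1 / (2 * q)) := by
  ext η
  simp only [effDomain, Set.mem_ofPred_eq, Set.mem_Iio]
  constructor
  · intro h
    by_contra h'
    exact h (kappa_relu_of_ge hq (not_lt.1 h'))
  · intro h
    rw [kappa_relu_of_lt hq h]
    exact EReal.coe_ne_top _

lemma kappa_ne_bot (σ : ℝ → ℝ) (hσ : Measurable σ) (η q : ℝ) : kappa σ η q ≠ ⊥ := by
  unfold kappa
  rw [Ne, ENNReal.log_eq_bot_iff, lintegral_eq_zero_iff (by fun_prop)]
  intro h
  have : ∀ᵐ t ∂(gaussianReal 0 1), False := by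
    filter_upwards [h] with t ht
    simp only [Pi.zero_apply, ENNReal.ofReal_eq_zero] at ht
    exact absurd ht (not_le.2 (Real.exp_pos _))
  exact (this.exists).elim fun _ h => h

/-- For q = 0 the domain is the whole line and steepness is void. For q > 0 the only boundary point
is 1/(2q), where w, and with it the derivative q f(w), tends to infinity. -/
lemma essentiallySmooth_kappa {q : ℝ} (hq : 0 ≤ q) :
    EssentiallySmooth (fun η => kappa relu η q) := by
  rcases hq.eq_or_lt with rfl | hq
  · have h0 : (fun η => kappa relu η 0) = fun _ => 0 :=
      funext fun η => kappa_relu_of_nonpos le_rfl η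
    have hd : effDomain (fun _ : ℝ => (0 : EReal)) = Set.univ := by
      ext; simp [effDomain]
    rw [h0]
    refine ⟨by simp, ?_, by simp [hd], ?_, ?_⟩
    · have : {p : ℝ × ℝ | (0 : EReal) ≤ (p.2 : EReal)} = {p : ℝ × ℝ | 0 ≤ p.2} := by
        ext p; simp
      rw [this]
      exact convex_halfSpace_ge (LinearMap.snd ℝ ℝ ℝ).isLinear 0
    · intro η _
      exact differentiableAt_const _
    · simp [hd]
  · refine ⟨fun η => kappa_ne_bot _ measurable_relu _ _, ?_, ?_, ?_, ?_⟩
    · have hconv : ConvexOn ℝ (Set.Iio (1 / (2 * q))) fun η => logMgf (η * q) := by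
        have := convexOn_logMgf.comp_linearMap (LinearMap.mul ℝ ℝ q)
        have hs : Set.Iio (1 / (2 * q)) = LinearMap.mul ℝ ℝ q ⁻¹' Set.Iio (1 / 2) := by
          ext η
          rw [Set.mem_Iio, lt_one_div_iff hq, mul_comm]
          rfl
        have hf : (fun η => logMgf (η * q)) = logMgf ∘ LinearMap.mul ℝ ℝ q := by
          ext η
          rw [mul_comm]
          rfl
        rwa [hs, hf]
      convert hconv.convex_epigraph using 1
      ext ⟨η, s⟩
      simp only [Set.mem_ofPred_eq, Set.mem_Iio]
      by_cases h : η < 1 / (2 * q)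
      · rw [kappa_relu_of_lt hq h, EReal.coe_le_coe_iff]
        exact (and_iff_right h).symm
      · rw [kappa_relu_of_ge hq (not_lt.1 h)]
        simp only [h, false_and, iff_false, top_le_iff]
        exact EReal.coe_ne_top _
    · rw [effDomain_kappa hq, interior_Iio]
      exact Set.nonempty_Iio
    · rw [effDomain_kappa hq, interior_Iio]
      exact fun η h => (hasDerivAt_kappa hq h).differentiableAt
    · rw [effDomain_kappa hq, interior_Iio, frontier_Iio]
      rintro _ rfl
      have h1 : Tendsto (fun η => η * q) (𝓝[<] (1 / (2 * q))) (𝓝[<] (1 / 2)) := by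
        refine tendsto_nhdsWithin_iff.2 ⟨?_, ?_⟩
        · refine Tendsto.mono_left ?_ nhdsWithin_le_nhds
          refine (continuous_mul_const q).tendsto' _ _ ?_
          field_simp
        · filter_upwards [self_mem_nhdsWithin] with η h using (lt_one_div_iff hq η).1 h
      have h2 := ((tendsto_cubicRatio.comp tendsto_invSqrt).comp h1).const_mul_atTop hq
      refine (tendsto_abs_atTop_atTop.comp h2).congr' ?_
      filter_upwards [self_mem_nhdsWithin] with η h
      rw [(hasDerivAt_kappa hq h).deriv]
      rfl

lemma kappa_finite_near_zero {q : ℝ} (hq : 0 ≤ q) :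
    ∀ᶠ η in 𝓝 (0 : ℝ), kappa relu η q ≠ ⊥ ∧ kappa relu η q ≠ ⊤ := by
  have h1 : Tendsto (fun η => η * q) (𝓝 0) (𝓝 0) := (continuous_mul_const q).tendsto' _ _ (by simp)
  filter_upwards [h1.eventually_lt_const (show (0 : ℝ) < 1 / 2 by norm_num)] with η h
  rw [kappa_relu_of_nonneg hq, kappa_relu_one_of_lt h]
  exact ⟨EReal.coe_ne_bot _, EReal.coe_ne_top _⟩

/-! ### The function `κ*` -/

/-- The substitution η ↦ ηq in the supremum. -/
lemma kappaStar_relu_of_pos {q : ℝ} (hq : 0 < q) (y : ℝ) :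
    kappaStar relu y q = kappaStar relu (y / q) 1 := by
  unfold kappaStar
  refine Equiv.iSup_congr (Equiv.mulRight₀ q hq.ne') fun η => ?_
  rw [kappa_relu_of_nonneg hq.le η]
  have : η * q * (y / q) = η * y := by field_simp
  simp only [Equiv.mulRight₀, Units.mulRight_apply, Units.val_mk0, this]

lemma kappaStar_relu_of_nonpos {q : ℝ} (hq : q ≤ 0) (y : ℝ) :
    kappaStar relu y q = if y = 0 then 0 else ⊤ := by
  unfold kappaStar
  simp_rw [kappa_relu_of_nonpos hq, sub_zero]
  split_ifs with h
  · simp [h]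
  · refine EReal.eq_top_iff_forall_lt _ |>.2 fun z => lt_iSup_iff.2 ⟨(z + 1) / y, ?_⟩
    rw [div_mul_cancel₀ _ h]
    exact EReal.coe_lt_coe_iff.2 (lt_add_one z)

lemma logMgf_nonpos {c : ℝ} (hc : c ≤ 0) : logMgf c ≤ 0 := by
  have hw := invSqrt_pos (show c < 1 / 2 by linarith)
  have : invSqrt c ≤ 1 := Real.rpow_le_one_of_one_le_of_nonpos (by linarith) (by norm_num)
  exact Real.log_nonpos (by positivity) (by linarith)

/-- As η tends to -∞ the linear term grows without bound, whereas κ stays nonpositive. -/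
lemma kappaStar_one_of_neg {y : ℝ} (hy : y < 0) : kappaStar relu y 1 = ⊤ := by
  refine EReal.eq_top_iff_forall_lt _ |>.2 fun z => lt_iSup_iff.2 ⟨(|z| + 1) / y, ?_⟩
  have h0 : (|z| + 1) / y ≤ 0 := div_nonpos_of_nonneg_of_nonpos (by positivity) hy.le
  rw [kappa_relu_one_of_lt (by linarith), div_mul_cancel₀ _ hy.ne, ← EReal.coe_sub,
    EReal.coe_lt_coe_iff]
  have := logMgf_nonpos h0
  linarith [le_abs_self z]

/-- The supremum is only approached, as c tends to -∞: there w tends to 0 and -log((w + 1)/2)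
increases to log 2. -/
lemma kappaStar_one_zero : kappaStar relu 0 1 = ((Real.log 2 : ℝ) : EReal) := by
  refine le_antisymm (iSup_le fun c => ?_) ?_
  · by_cases hc : c < 1 / 2
    · rw [kappa_relu_one_of_lt hc, ← EReal.coe_sub, EReal.coe_le_coe_iff]
      have hw := invSqrt_pos hc
      have : Real.log (1 / 2) ≤ logMgf c := Real.log_le_log (by norm_num) (by linarith)
      rw [one_div, Real.log_inv] at this
      linarith
    · rw [kappa_relu_one_of_ge (not_lt.1 hc)]
      simp
  · have h1 : Tendsto (fun c : ℝ => 1 - 2 * c) atBot atTop :=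
      tendsto_atTop_add_const_left _ 1
        (tendsto_neg_atBot_atTop.comp (tendsto_id.const_mul_atBot two_pos))
    have h2 : Tendsto invSqrt atBot (𝓝 0) :=
      (tendsto_rpow_neg_atTop (show (0 : ℝ) < 1 / 2 by norm_num)).comp h1
    have h3 : Tendsto (fun c => (((-logMgf c : ℝ)) : EReal)) atBot (𝓝 ((Real.log 2 : ℝ) : EReal)) := by
      refine (continuous_coe_real_ereal.tendsto _).comp ?_
      have h4 : Tendsto (fun c => (invSqrt c + 1) / 2) atBot (𝓝 ((0 + 1) / 2)) :=
        (h2.add_const 1).div_const 2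
      have h5 := ((Real.continuousAt_log (by norm_num : ((0 : ℝ) + 1) / 2 ≠ 0)).tendsto.comp h4).neg
      have h6 : -Real.log ((0 + 1) / 2) = Real.log 2 := by
        rw [zero_add, one_div, Real.log_inv, neg_neg]
      rw [h6] at h5
      exact h5
    refine le_of_tendsto h3 ?_
    filter_upwards [eventually_lt_atBot (1 / 2 : ℝ)] with c hc
    refine le_iSup_of_le c ?_
    rw [kappa_relu_one_of_lt hc, ← EReal.coe_sub]
    simp

lemma kappaStar_one_eq {c : ℝ} (hc : c < 1 / 2) :
    kappaStar relu (cubicRatio (invSqrt c)) 1 =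
      ((c * cubicRatio (invSqrt c) - logMgf c : ℝ) : EReal) := by
  refine le_antisymm (iSup_le fun d => ?_) ?_
  · by_cases hd : d < 1 / 2
    · rw [kappa_relu_one_of_lt hd, ← EReal.coe_sub, EReal.coe_le_coe_iff]
      have := logMgf_tangent hc hd
      linarith
    · rw [kappa_relu_one_of_ge (not_lt.1 hd)]
      simp
  · refine le_iSup_of_le c ?_
    rw [kappa_relu_one_of_lt hc, ← EReal.coe_sub]

lemma etaStar_mul {y q : ℝ} (hq : 0 < q) :
    etaStar y q * q = (1 - (cubicRatioInv (y / q) ^ 2)⁻¹) / 2 := by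
  unfold etaStar
  field_simp

lemma invSqrt_half {z : ℝ} (hz : 0 < z) : invSqrt ((1 - (z ^ 2)⁻¹) / 2) = z := by
  have h2 : (1 - (z ^ 2)⁻¹) / 2 < 1 / 2 := by
    have : 0 < (z ^ 2)⁻¹ := by positivity
    linarith
  rw [invSqrt_eq h2, show 1 - 2 * ((1 - (z ^ 2)⁻¹) / 2) = (z⁻¹) ^ 2 by rw [inv_pow]; ring,
    Real.sqrt_sq (by positivity), inv_inv]

lemma half_lt {z : ℝ} (hz : 0 < z) : (1 - (z ^ 2)⁻¹) / 2 < 1 / 2 := by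
  have : 0 < (z ^ 2)⁻¹ := by positivity
  linarith

lemma etaStar_lt {y q : ℝ} (hq : 0 < q) (hy : 0 < y) : etaStar y q < 1 / (2 * q) := by
  rw [lt_one_div_iff hq, etaStar_mul hq]
  exact half_lt (cubicRatioInv_pos (by positivity))

lemma invSqrt_etaStar {y q : ℝ} (hq : 0 < q) (hy : 0 < y) :
    invSqrt (etaStar y q * q) = cubicRatioInv (y / q) := by
  rw [etaStar_mul hq, invSqrt_half (cubicRatioInv_pos (by positivity))]

lemma deriv_kappa_eq_iff {y q : ℝ} (hq : 0 < q) (hy : 0 < y) (η : ℝ) :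
    (η < 1 / (2 * q) ∧ deriv (fun t => (kappa relu t q).toReal) η = y) ↔ η = etaStar y q := by
  have hyq : 0 < y / q := by positivity
  constructor
  · rintro ⟨h, hd⟩
    rw [(hasDerivAt_kappa hq h).deriv] at hd
    have hc := (lt_one_div_iff hq η).1 h
    have hce := (lt_one_div_iff hq _).1 (etaStar_lt hq hy)
    have h1 : cubicRatio (invSqrt (η * q)) = cubicRatio (invSqrt (etaStar y q * q)) := by
      rw [invSqrt_etaStar hq hy, cubicRatio_cubicRatioInv hyq, ← hd]
      field_simp
    have h2 := cubicRatio_strictMonoOn.injOn (invSqrt_pos hc) (invSqrt_pos hce) h1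
    exact mul_right_cancel₀ hq.ne' (invSqrt_strictMonoOn.injOn hc hce h2)
  · rintro rfl
    refine ⟨etaStar_lt hq hy, ?_⟩
    rw [(hasDerivAt_kappa hq (etaStar_lt hq hy)).deriv, invSqrt_etaStar hq hy,
      cubicRatio_cubicRatioInv hyq]
    field_simp

lemma kappaStar_relu_eq {y q : ℝ} (hq : 0 < q) (hy : 0 < y) :
    kappaStar relu y q = ((etaStar y q * y - logMgf (etaStar y q * q) : ℝ) : EReal) := by
  have hyq : 0 < y / q := by positivity
  have h := kappaStar_one_eq ((lt_one_div_iff hq _).1 (etaStar_lt hq hy))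
  rw [invSqrt_etaStar hq hy, cubicRatio_cubicRatioInv hyq] at h
  rw [kappaStar_relu_of_pos hq, h]
  congr 2
  field_simp

/-! ### Large deviations of the empirical second moment of the activations -/

/-- The mean of the squared ReLUs of `k` numbers. -/
noncomputable def reluMean (k : ℕ) (t : Fin k → ℝ) : ℝ := (∑ j, relu (t j) ^ 2) / k

lemma continuous_reluMean (k : ℕ) : Continuous (reluMean k) := by
  have := continuous_relu
  unfold reluMean
  fun_prop

/-- The law of the mean of `k` independent squared ReLUs of standard normal variables. -/
noncomputable def reluMeanLaw (k : ℕ) : Measure ℝ :=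
  (Measure.pi fun _ : Fin k => gaussianReal 0 1).map (reluMean k)

instance (k : ℕ) : IsProbabilityMeasure (reluMeanLaw k) :=
  Measure.isProbabilityMeasure_map (continuous_reluMean k).measurable.aemeasurable

lemma exp_reluMean (k : ℕ) (s : ℝ) (t : Fin k → ℝ) :
    Real.exp (s * reluMean k t) = ∏ j, Real.exp (s / k * relu (t j) ^ 2) := by
  rw [← Real.exp_sum, ← Finset.mul_sum, reluMean]
  congr 1
  ring

lemma integrable_exp_reluMeanLaw {k : ℕ} {s : ℝ} (hs : s / k < 1 / 2) :
    Integrable (fun x => Real.exp (s * x)) (reluMeanLaw k) := by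
  rw [reluMeanLaw, integrable_map_measure (by fun_prop)
    (continuous_reluMean k).measurable.aemeasurable]
  have : (fun x => Real.exp (s * x)) ∘ reluMean k =
      fun t => ∏ j, Real.exp (s / k * relu (t j) ^ 2) := funext fun t => exp_reluMean k s t
  rw [this]
  exact Integrable.fintype_prod fun _ => integrable_exp_relu_sq hs

lemma log_integral_exp_reluMeanLaw {k : ℕ} {s : ℝ} (hs : s / k < 1 / 2) :
    Real.log (∫ x, Real.exp (s * x) ∂(reluMeanLaw k)) = k * logMgf (s / k) := by
  rw [reluMeanLaw, integral_map (continuous_reluMean k).measurable.aemeasurable (by fun_prop)]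
  simp_rw [exp_reluMean]
  rw [integral_fintype_prod_eq_pow (fun x : ℝ => Real.exp (s / k * relu x ^ 2)),
    integral_exp_relu_sq hs, Real.log_pow, Fintype.card_fin, logMgf]

/-- All k Gaussians are nonpositive with probability 2^(-k). This atom supplies the lower bound at
0, a value that is not the derivative of `logMgf` at any point. -/
lemma measure_reluMeanLaw_zero (k : ℕ) : (1 / 2) ^ k ≤ (reluMeanLaw k).real {0} := by
  rw [reluMeanLaw, map_measureReal_apply (continuous_reluMean k).measurable
    (measurableSet_singleton 0)]
  calc ((1 : ℝ) / 2) ^ k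
      = (Measure.pi fun _ : Fin k => gaussianReal 0 1).real (Set.univ.pi fun _ => Set.Iic 0) := by
        rw [measureReal_def, Measure.pi_pi, gaussianReal_Iic, ENNReal.toReal_prod]
        simp
    _ ≤ _ := by
        refine measureReal_mono fun t ht => ?_
        have : ∀ j, relu (t j) = 0 := fun j => max_eq_right (ht j trivial)
        simp [reluMean, this]

/-- The rate function of the empirical second moment, for a limiting width ratio `γ`. -/
noncomputable def reluRate (γ : ℝ≥0∞) (s : ℝ) : EReal := J relu 0 1 γ s 1

lemma reluRate_top (s : ℝ) : reluRate ⊤ s = Delta s (1 / 2) := by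
  simp [reluRate, J, meanSq_relu]

lemma reluRate_of_ne_top {γ : ℝ≥0∞} (hγ : γ ≠ ⊤) (s : ℝ) :
    reluRate γ s = (γ.toReal : EReal) * kappaStar relu s 1 := by
  simp [reluRate, J, hγ]

lemma kappa_zero_one : kappa relu 0 1 = 0 := by
  rw [kappa_relu_one_of_lt (by norm_num), logMgf, invSqrt]
  simp

lemma kappaStar_nonneg (s : ℝ) : 0 ≤ kappaStar relu s 1 :=
  le_iSup_of_le 0 (by simp [kappa_zero_one])

section

variable {k : ℕ → ℕ} {v : ℕ → ℝ}

lemma limCgf_reluMeanLaw_of_tendsto {g : ℝ} (hg : 0 < g)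
    (hk : Tendsto (fun n => (k n : ℝ) / v n) atTop (𝓝 g)) {θ : ℝ} (hθ : θ / g < 1 / 2) :
    LimCgf (fun n => reluMeanLaw (k n)) v θ (g * logMgf (θ / g)) := by
  have h1 : Tendsto (fun n => θ / ((k n : ℝ) / v n)) atTop (𝓝 (θ / g)) :=
    tendsto_const_nhds.div hk hg.ne'
  have h2 : ∀ n, v n * θ / k n = θ / ((k n : ℝ) / v n) := fun n => by
    rw [div_div_eq_mul_div, mul_comm]
  refine ⟨?_, ?_⟩
  · filter_upwards [h1.eventually_lt_const hθ] with n hn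
    rw [← h2] at hn
    exact integrable_exp_reluMeanLaw hn
  · refine (hk.mul ((hasDerivAt_logMgf hθ).continuousAt.tendsto.comp h1)).congr' ?_
    filter_upwards [h1.eventually_lt_const hθ] with n hn
    rw [← h2] at hn
    rw [log_integral_exp_reluMeanLaw hn, h2, mul_div_right_comm]
    rfl

lemma limCgf_reluMeanLaw_of_atTop
    (hk : Tendsto (fun n => (k n : ℝ) / v n) atTop atTop) (θ : ℝ) :
    LimCgf (fun n => reluMeanLaw (k n)) v θ (θ / 2) := by
  have h1 : Tendsto (fun n => θ / ((k n : ℝ) / v n)) atTop (𝓝 0) := hk.const_div_atTop θ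
  have h2 : ∀ n, v n * θ / k n = θ / ((k n : ℝ) / v n) := fun n => by
    rw [div_div_eq_mul_div, mul_comm]
  have hθ : (0 : ℝ) < 1 / 2 := by norm_num
  refine ⟨?_, ?_⟩
  · filter_upwards [h1.eventually_lt_const hθ] with n hn
    rw [← h2] at hn
    exact integrable_exp_reluMeanLaw hn
  -- With r = k/v tending to infinity, r · logMgf(θ/r) tends to θ times the derivative 1/2 of
  -- `logMgf` at 0: only the mean survives.
  · have h3 := (hasDerivAt_logMgf hθ).hasFDerivAt.lim θ
      (tendsto_norm_atTop_atTop.comp hk)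
    have h4 : logMgf 0 = 0 := by simp [logMgf, invSqrt]
    have h5 : cubicRatio (invSqrt 0) = 1 / 2 := by norm_num [cubicRatio, invSqrt]
    have h6 : (ContinuousLinearMap.toSpanSingleton ℝ (cubicRatio (invSqrt 0))) θ = θ / 2 := by
      simp [h5, div_eq_mul_inv]
    rw [h6] at h3
    refine h3.congr' ?_
    filter_upwards [h1.eventually_lt_const hθ] with n hn
    rw [← h2] at hn
    rw [log_integral_exp_reluMeanLaw hn, h2, h4, mul_div_right_comm]
    simp [div_eq_mul_inv, mul_comm]

/-- Positive points are exposed by a derivative, 0 is handled by the atom, and negative points have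
infinite rate. Upper bounds come from Chebyshev's inequality at a nearly optimal η. -/
lemma localLDP_reluMeanLaw_of_tendsto {g : ℝ} (hg : 0 < g) (hv : IsSpeed v)
    (hk : Tendsto (fun n => (k n : ℝ) / v n) atTop (𝓝 g)) :
    LocalLDP (fun n => reluMeanLaw (k n)) v (fun s => (g : EReal) * kappaStar relu s 1) := by
  have hlim : ∀ c < 1 / 2, LimCgf (fun n => reluMeanLaw (k n)) v (g * c) (g * logMgf c) := by
    intro c hc
    have := limCgf_reluMeanLaw_of_tendsto hg hk (θ := g * c) (by field_simp; linarith)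
    rwa [mul_div_cancel_left₀ _ hg.ne'] at this
  refine ⟨fun s => mul_nonneg (EReal.coe_nonneg.2 hg.le) (kappaStar_nonneg s),
    fun x c hc δ hδ => ?_, fun x c hc => ?_, fun M => ?_⟩
  · rcases lt_trichotomy x 0 with hx | rfl | hx
    · rw [kappaStar_one_of_neg hx, EReal.coe_mul_top_of_pos hg] at hc
      simp at hc
    · rw [kappaStar_one_zero] at hc
      have hc' : g * Real.log 2 < c := by exact_mod_cast hc
      filter_upwards [(hk.mul_const (Real.log 2)).eventually_lt_const hc'] with n hn
      have h2 : (k n : ℝ) * Real.log 2 ≤ c * v n := by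
        rw [div_mul_eq_mul_div, div_lt_iff₀ (hv.pos n)] at hn
        exact hn.le
      calc Real.exp (-(c * v n)) ≤ Real.exp (-(k n * Real.log 2)) := by
            rw [Real.exp_le_exp]; linarith
        _ = (1 / 2) ^ k n := by
            rw [← mul_neg, Real.exp_nat_mul, Real.exp_neg, Real.exp_log two_pos, one_div]
        _ ≤ _ := (measure_reluMeanLaw_zero _).trans
            (measureReal_mono (by simpa using hδ))
    · have hη := (lt_one_div_iff one_pos _).1 (etaStar_lt one_pos hx)
      have hinv := invSqrt_etaStar one_pos hx
      rw [kappaStar_relu_eq one_pos hx] at hc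
      simp only [mul_one, div_one] at *
      set c₀ := etaStar x 1
      have hval : cubicRatio (invSqrt c₀) = x := by rw [hinv, cubicRatio_cubicRatioInv hx]
      have hc' : g * (c₀ * x - logMgf c₀) < c := by exact_mod_cast hc
      have hdiv : g * c₀ / g = c₀ := mul_div_cancel_left₀ _ hg.ne'
      refine LimCgf.le_ball (Λ := fun θ => g * logMgf (θ / g)) (θ := g * c₀) ?_ ?_ hv ?_ hδ
      · have : ContinuousAt (fun θ : ℝ => θ / g) (g * c₀) := by fun_prop
        filter_upwards [this.eventually_lt_const (show g * c₀ / g < 1 / 2 by rwa [hdiv])] with θ hθ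
        exact limCgf_reluMeanLaw_of_tendsto hg hk hθ
      · have h1 : HasDerivAt logMgf x (g * c₀ / g) := by
          rw [hdiv, ← hval]; exact hasDerivAt_logMgf hη
        have h2 : HasDerivAt (fun θ : ℝ => θ / g) (1 / g) (g * c₀) :=
          (hasDerivAt_id _).div_const g
        have h3 := (HasDerivAt.comp (h₂ := logMgf) (g * c₀) h1 h2).const_mul g
        refine h3.congr_deriv ?_
        field_simp
      · simp only [hdiv]
        linarith
  · have h1 : ((c / g : ℝ) : EReal) < kappaStar relu x 1 := by
      by_contra h
      have := mul_le_mul_of_nonneg_left (not_lt.1 h) (EReal.coe_nonneg.2 hg.le)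
      rw [← EReal.coe_mul, mul_div_cancel₀ _ hg.ne'] at this
      exact absurd hc (not_lt.2 this)
    obtain ⟨η, hη⟩ := lt_iSup_iff.1 h1
    by_cases h2 : η < 1 / 2
    · rw [kappa_relu_one_of_lt h2, ← EReal.coe_sub, EReal.coe_lt_coe_iff, div_lt_iff₀ hg] at hη
      exact (hlim η h2).ball_le hv (by linarith)
    · rw [kappa_relu_one_of_ge (not_lt.1 h2)] at hη
      simp at hη
  -- Any multiple of g below g/2 would do, since the moments are controlled for arguments less than
  -- 1/2.
  · refine LimCgf.tight (s := g * (1 / 4)) (by positivity) (hlim _ (by norm_num)) ?_ hv M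
      (b := g * logMgf (-(1 / 4)))
    rw [← mul_neg]
    exact hlim _ (by norm_num)

lemma localLDP_reluMeanLaw_of_atTop (hv : IsSpeed v)
    (hk : Tendsto (fun n => (k n : ℝ) / v n) atTop atTop) :
    LocalLDP (fun n => reluMeanLaw (k n)) v (fun s => Delta s (1 / 2)) := by
  have hlim := limCgf_reluMeanLaw_of_atTop hk
  refine ⟨fun r => ?_, fun x c hc δ hδ => ?_, fun x c hc => ?_, fun M => ?_⟩
  · unfold Delta; split_ifs <;> simp
  · unfold Delta at hc
    split_ifs at hc with h
    · have hc' : 0 < c := by exact_mod_cast hc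
      refine LimCgf.le_ball (Λ := fun θ => θ / 2) (θ := 0) (Eventually.of_forall hlim) ?_ hv
        (by simpa using hc') hδ
      rw [h]
      exact (hasDerivAt_id _).div_const 2
    · simp at hc
  · unfold Delta at hc
    split_ifs at hc with h
    · have hc' : c < 0 := by exact_mod_cast hc
      exact (hlim 0).ball_le hv (by simpa using hc')
    · have : x - 1 / 2 ≠ 0 := sub_ne_zero.2 h
      -- The limit is linear, so away from 1/2 the exponent θ(x - 1/2) can be given any value; this
      -- θ gives c + 1.
      refine (hlim ((c + 1) / (x - 1 / 2))).ball_le hv ?_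
      have h2 : (c + 1) / (x - 1 / 2) * x - (c + 1) / (x - 1 / 2) / 2 = c + 1 := by
        rw [show (c + 1) / (x - 1 / 2) * x - (c + 1) / (x - 1 / 2) / 2 =
          (c + 1) / (x - 1 / 2) * (x - 1 / 2) by ring, div_mul_cancel₀ _ this]
      rw [h2]
      exact lt_add_one c
  · exact LimCgf.tight one_pos (hlim 1) (hlim (-1)) hv M

lemma localLDP_reluMeanLaw {γ : ℝ≥0∞} (hγ : 1 ≤ γ) (hv : IsSpeed v)
    (hk : Tendsto (fun n => ENNReal.ofReal ((k n : ℝ) / v n)) atTop (𝓝 γ)) :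
    LocalLDP (fun n => reluMeanLaw (k n)) v (reluRate γ) := by
  by_cases h : γ = ⊤
  · subst h
    rw [funext reluRate_top]
    exact localLDP_reluMeanLaw_of_atTop hv (ENNReal.tendsto_ofReal_nhds_top.1 hk)
  · rw [funext (reluRate_of_ne_top h)]
    refine localLDP_reluMeanLaw_of_tendsto
      (ENNReal.toReal_pos (zero_lt_one.trans_le hγ).ne' h) hv ?_
    refine ((ENNReal.tendsto_toReal h).comp hk).congr fun n => ?_
    exact ENNReal.toReal_ofReal (div_nonneg (Nat.cast_nonneg _) (hv.pos n).le)

/-! ### Large deviations of rescaled Gaussian vectors -/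

instance (s : ℝ) : IsProbabilityMeasure ((gaussianReal 0 1).map fun t : ℝ => s * t) :=
  Measure.isProbabilityMeasure_map (by fun_prop)

/-- The scaled cumulant generating function equals θ²/2 for every n, and every x is its derivative
at θ = x. -/
lemma localLDP_gaussian (hv : IsSpeed v) :
    LocalLDP (fun n => (gaussianReal 0 1).map fun t => (√(v n))⁻¹ * t) v
      (fun x => ((x ^ 2 / 2 : ℝ) : EReal)) := by
  have hlim : ∀ θ, LimCgf (fun n => (gaussianReal 0 1).map fun t => (√(v n))⁻¹ * t) v θ
      (θ ^ 2 / 2) := by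
    intro θ
    have heq : ∀ n t, v n * θ * ((√(v n))⁻¹ * t) = √(v n) * θ * t := by
      intro n t
      have h := Real.mul_self_sqrt (hv.pos n).le
      have h0 : √(v n) ≠ 0 := (Real.sqrt_pos.2 (hv.pos n)).ne'
      calc v n * θ * ((√(v n))⁻¹ * t) = √(v n) * √(v n) * θ * ((√(v n))⁻¹ * t) := by rw [h]
        _ = √(v n) * θ * t := by field_simp
    refine ⟨Eventually.of_forall fun n => ?_, tendsto_const_nhds.congr fun n => ?_⟩
    · rw [integrable_map_measure (by fun_prop) (by fun_prop)]
      simp only [Function.comp_def, heq]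
      exact integrable_exp_mul_gaussianReal _
    · rw [integral_map (by fun_prop) (by fun_prop)]
      simp_rw [heq]
      have := mgf_gaussianReal (p := gaussianReal 0 1) (X := id) (μ := 0) (v := 1)
        (by simp) (√(v n) * θ)
      simp only [mgf, id] at this
      rw [this, Real.log_exp, mul_pow, Real.sq_sqrt (hv.pos n).le]
      have := (hv.pos n).ne'
      simp only [zero_mul, NNReal.coe_one, one_mul, zero_add]
      field_simp
  refine ⟨fun x => ?_, fun x c hc δ hδ => ?_, fun x c hc => ?_, fun M => ?_⟩
  · exact EReal.coe_nonneg.2 (by positivity)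
  · have hc' : x ^ 2 / 2 < c := by exact_mod_cast hc
    refine LimCgf.le_ball (Λ := fun θ => θ ^ 2 / 2) (θ := x) (Eventually.of_forall hlim) ?_ hv
      (by linarith) hδ
    refine ((hasDerivAt_pow 2 x).div_const 2).congr_deriv ?_
    simp
  · have hc' : c < x ^ 2 / 2 := by exact_mod_cast hc
    exact (hlim x).ball_le hv (by linarith)
  · exact LimCgf.tight one_pos (hlim 1) (hlim (-1)) hv M

end

/-! ### The law of the output of the network -/

/-- The standard Gaussian measure on `ℝ^m`. -/
noncomputable abbrev stdPi (m : ℕ) : Measure (Fin m → ℝ) := Measure.pi fun _ => gaussianReal 0 1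

/-- Both sides have the same characteristic function. Variances may vanish, so no densities are
used. -/
lemma pi_gaussianReal_map_sum {ι : Type*} [Fintype ι] (s : ι → ℝ≥0) (c : ι → ℝ) :
    (Measure.pi fun o => gaussianReal 0 (s o)).map (fun t : ι → ℝ => ∑ o, c o * t o) =
      (gaussianReal 0 1).map fun t => √(∑ o, c o ^ 2 * s o) * t := by
  have hind : iIndepFun (fun o (t : ι → ℝ) => c o * t o)
      (Measure.pi fun o => gaussianReal 0 (s o)) :=
    iIndepFun_pi (μ := fun o => gaussianReal 0 (s o)) (X := fun o (u : ℝ) => c o * u)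
      fun o => Measurable.aemeasurable (by fun_prop)
  refine Measure.ext_of_charFun (funext fun u => ?_)
  rw [iIndepFun.charFun_map_fun_sum_eq_prod (fun o => Measurable.aemeasurable (by fun_prop)) hind]
  have h1 : ∀ o, (Measure.pi fun o => gaussianReal 0 (s o)).map (fun t : ι → ℝ => c o * t o) =
      gaussianReal 0 (.mk (c o ^ 2) (sq_nonneg _) * s o) := by
    intro o
    have h2 := (measurePreserving_eval (fun o => gaussianReal 0 (s o)) o).map_eq
    have h3 : (fun t : ι → ℝ => c o * t o) = (fun u : ℝ => c o * u) ∘ Function.eval o := rfl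
    rw [h3, ← Measure.map_map (by fun_prop) (by fun_prop), h2, gaussianReal_map_const_mul, mul_zero]
  rw [gaussianReal_map_const_mul]
  simp only [Finset.prod_apply, h1, charFun_gaussianReal]
  rw [← Complex.exp_sum]
  congr 1
  have h4 : 0 ≤ ∑ o, c o ^ 2 * (s o : ℝ) := Finset.sum_nonneg fun o _ => by positivity
  simp only [mul_zero, Complex.ofReal_zero, zero_mul, zero_sub, mul_one]
  rw [Finset.sum_neg_distrib, ← Finset.sum_div, ← Finset.sum_mul]
  congr 3
  simp only [NNReal.coe_mul, NNReal.coe_mk, Real.sq_sqrt h4]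
  push_cast
  rfl

/-- The law of a family of affine functions of independent Gaussian variables. -/
lemma pi_pi_gaussianReal_map_sum {ι : Type*} [Fintype ι] (m : ℕ) (s : ι → ℝ≥0) (c : ι → ℝ) :
    (Measure.pi fun _ : Fin m => Measure.pi fun o => gaussianReal 0 (s o)).map
        (fun T i => ∑ o, c o * T i o) =
      (stdPi m).map fun t i => √(∑ o, c o ^ 2 * s o) * t i := by
  have h1 := Measure.pi_map_pi (μ := fun _ : Fin m => Measure.pi fun o => gaussianReal 0 (s o))
    (f := fun _ (t : ι → ℝ) => ∑ o, c o * t o) fun _ => Measurable.aemeasurable (by fun_prop)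
  have h2 := Measure.pi_map_pi (μ := fun _ : Fin m => gaussianReal 0 1)
    (f := fun _ (t : ℝ) => √(∑ o, c o ^ 2 * s o) * t) fun _ => by fun_prop
  rw [h1, h2]
  simp_rw [pi_gaussianReal_map_sum]

/-- If the conditional law of `F (Z, θ)` given `Z` depends on `g Z` only, then so does the law. -/
lemma map_eq_prod_map_of_indepFun {Ω E Θ T Y : Type*} [MeasurableSpace Ω] [MeasurableSpace E]
    [MeasurableSpace Θ] [MeasurableSpace T] [MeasurableSpace Y] {P : Measure Ω}
    [IsProbabilityMeasure P] {τ : Measure T} [SFinite τ] {Z : Ω → E} {θ : Ω → Θ} {F : E × Θ → Y}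
    {g : E → ℝ} {F' : ℝ × T → Y} (hZ : Measurable Z) (hθ : Measurable θ) (hF : Measurable F)
    (hg : Measurable g) (hF' : Measurable F') (hind : IndepFun Z θ P)
    (h : ∀ z, (P.map θ).map (fun t => F (z, t)) = τ.map fun t => F' (g z, t)) :
    P.map (fun ω => F (Z ω, θ ω)) = ((P.map fun ω => g (Z ω)).prod τ).map F' := by
  have := Measure.isProbabilityMeasure_map (μ := P) hZ.aemeasurable
  have := Measure.isProbabilityMeasure_map (μ := P) hθ.aemeasurable
  have h1 : P.map (fun ω => F (Z ω, θ ω)) = ((P.map Z).prod (P.map θ)).map F := by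
    rw [← (indepFun_iff_map_prod_eq_prod_map_map hZ.aemeasurable hθ.aemeasurable).1 hind,
      Measure.map_map hF (hZ.prodMk hθ)]
    rfl
  have h2 : P.map (fun ω => g (Z ω)) = (P.map Z).map g := (Measure.map_map hg hZ).symm
  rw [h1, h2]
  ext s hs
  rw [Measure.map_apply hF hs, Measure.map_apply hF' hs, Measure.prod_apply (hF hs),
    Measure.prod_apply (hF' hs), lintegral_map (measurable_measure_prodMk_left (hF' hs)) hg]
  refine lintegral_congr fun z => ?_
  have h3 := congrArg (fun ν => ν s) (h z)
  have m1 : Measurable fun t => F (z, t) := hF.comp (by fun_prop)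
  have m2 : Measurable fun t => F' (g z, t) := hF'.comp (by fun_prop)
  rwa [Measure.map_apply m1 hs, Measure.map_apply m2 hs] at h3

/-- The pre-activations of a layer, given those of the previous one. -/
lemma map_layer_eq {Ω : Type*} [MeasurableSpace Ω] {P : Measure Ω} [IsProbabilityMeasure P]
    {Cb CW : ℝ} (hCb : 0 ≤ Cb) (hCW : 0 < CW) {m k : ℕ} {Z : Ω → Fin k → ℝ}
    {θ : Ω → Fin m → Option (Fin k) → ℝ} (hZ : Measurable Z) (hθ : Measurable θ)
    (hind : IndepFun Z θ P)
    (hlaw : P.map θ = Measure.pi fun _ => Measure.pi fun o : Option (Fin k) =>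
      gaussianReal 0 (o.elim Cb.toNNReal fun _ => (CW / k).toNNReal)) :
    P.map (fun ω i => θ ω i none + ∑ j, θ ω i (some j) * Z ω j) =
      ((P.map fun ω => Cb + CW / k * ∑ j, Z ω j ^ 2).prod (stdPi m)).map
        fun p i => √p.1 * p.2 i := by
  refine map_eq_prod_map_of_indepFun (F := fun q : (Fin k → ℝ) × (Fin m → Option (Fin k) → ℝ) =>
      fun i => q.2 i none + ∑ j, q.2 i (some j) * q.1 j)
    (g := fun z => Cb + CW / k * ∑ j, z j ^ 2) hZ hθ (by fun_prop) (by fun_prop) (by fun_prop)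
    hind fun z => ?_
  -- The index `none` stands for the bias, with coefficient 1, and `some j` for the weight that
  -- multiplies z_j.
  have h := pi_pi_gaussianReal_map_sum m
    (fun o : Option (Fin k) => o.elim Cb.toNNReal fun _ => (CW / k).toNNReal)
    (fun o => o.elim 1 z)
  rw [hlaw]
  simp only [Fintype.sum_option, Option.elim_none, Option.elim_some, one_pow, one_mul] at h
  have hk : 0 ≤ CW / k := div_nonneg hCW.le (Nat.cast_nonneg k)
  simp only [Real.coe_toNNReal _ hCb, Real.coe_toNNReal _ hk, ← Finset.sum_mul] at h
  simp_rw [mul_comm _ (z _), mul_comm (CW / k)]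
  exact h

/-- The law of the conditional variance of layer `ℓ + 1`, given the previous layer. -/
noncomputable def varLaw (Cb CW : ℝ) (N : ℕ → ℕ) {n₀ : ℕ} (x : Fin n₀ → ℝ) : ℕ → Measure ℝ
  | 0 => Measure.dirac (initVar Cb CW x)
  | ℓ + 1 => ((varLaw Cb CW N x ℓ).prod (reluMeanLaw (N (ℓ + 1)))).map
      fun p => Cb + CW * (max p.1 0 * p.2)

instance (Cb CW : ℝ) (N : ℕ → ℕ) {n₀ : ℕ} (x : Fin n₀ → ℝ) (ℓ : ℕ) :
    IsProbabilityMeasure (varLaw Cb CW N x ℓ) := by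
  induction ℓ with
  | zero => unfold varLaw; infer_instance
  | succ ℓ ih =>
    unfold varLaw
    exact Measure.isProbabilityMeasure_map (by fun_prop)

/-- Only parameters of layers up to ℓ + 1 enter the hypotheses, so the σ-algebra on Ω can also be
taken to be the one generated by those layers; independence of the next layer rests on this. -/
lemma measurable_preact {Ω : Type*} [MeasurableSpace Ω] {σ : ℝ → ℝ} (hσ : Measurable σ) {N : ℕ → ℕ}
    {b : ℕ → ℕ → Ω → ℝ} {W : ℕ → ℕ → ℕ → Ω → ℝ} {n₀ : ℕ} (hN : N 0 = n₀) (x : Fin n₀ → ℝ) (ℓ : ℕ)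
    (hb : ∀ l i, 1 ≤ l → l ≤ ℓ + 1 → i < N l → Measurable (b l i))
    (hW : ∀ l i j, 1 ≤ l → l ≤ ℓ + 1 → i < N l → j < N (l - 1) → Measurable (W l i j))
    {i : ℕ} (hi : i < N (ℓ + 1)) : Measurable (preact σ N b W x ℓ i) := by
  induction ℓ generalizing i with
  | zero =>
    exact (hb 1 i le_rfl le_rfl hi).add (Finset.measurable_sum _ fun r _ =>
      (hW 1 i r le_rfl le_rfl hi (by simp [hN])).mul_const _)
  | succ ℓ ih =>
    refine (hb _ i (by omega) le_rfl hi).add (Finset.measurable_sum _ fun j hj => ?_)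
    have hj' := Finset.mem_range.1 hj
    exact (hW _ i j (by omega) le_rfl hi hj').mul (hσ.comp
      (ih (fun l i h1 h2 => hb l i h1 (by omega)) (fun l i j h1 h2 => hW l i j h1 (by omega)) hj'))

lemma measurable_relu_preact {Ω : Type*} [MeasurableSpace Ω] {N : ℕ → ℕ}
    {b : ℕ → ℕ → Ω → ℝ} {W : ℕ → ℕ → ℕ → Ω → ℝ} {n₀ : ℕ} (hN : N 0 = n₀) (x : Fin n₀ → ℝ) (ℓ : ℕ)
    (hb : ∀ l i, 1 ≤ l → l ≤ ℓ + 1 → i < N l → Measurable (b l i))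
    (hW : ∀ l i j, 1 ≤ l → l ≤ ℓ + 1 → i < N l → j < N (l - 1) → Measurable (W l i j)) :
    Measurable fun ω (j : Fin (N (ℓ + 1))) => relu (preact relu N b W x ℓ j ω) :=
  measurable_pi_iff.2 fun j =>
    measurable_relu.comp (measurable_preact measurable_relu hN x ℓ hb hW j.2)

/-! ### Independence of the parameters of different layers -/

section

variable {Ω : Type*} {L : ℕ} {N : ℕ → ℕ} {b : ℕ → ℕ → Ω → ℝ} {W : ℕ → ℕ → ℕ → Ω → ℝ}

/-- The family of all parameters. -/
def param (L : ℕ) (N : ℕ → ℕ) (b : ℕ → ℕ → Ω → ℝ) (W : ℕ → ℕ → ℕ → Ω → ℝ) :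
    BiasIndex L N ⊕ WeightIndex L N → Ω → ℝ :=
  Sum.elim (fun p : BiasIndex L N => b p.1.1 p.1.2)
    (fun p : WeightIndex L N => W p.1.1 p.1.2.1 p.1.2.2)

/-- The layer to which a parameter belongs. -/
def paramLayer (L : ℕ) (N : ℕ → ℕ) : BiasIndex L N ⊕ WeightIndex L N → ℕ :=
  Sum.elim (fun p : BiasIndex L N => p.1.1) (fun p : WeightIndex L N => p.1.1)

/-- The σ-algebra of the parameters of a set of layers. -/
@[reducible] def layerAlg (L : ℕ) (N : ℕ → ℕ) (b : ℕ → ℕ → Ω → ℝ) (W : ℕ → ℕ → ℕ → Ω → ℝ) (S : Set ℕ) :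
    MeasurableSpace Ω :=
  ⨆ p ∈ paramLayer L N ⁻¹' S, MeasurableSpace.comap (param L N b W p) inferInstance

lemma measurable_layerAlg_bias {S : Set ℕ} {l i : ℕ} (h1 : 1 ≤ l) (h2 : l ≤ L + 1) (hi : i < N l)
    (hl : l ∈ S) : Measurable[layerAlg L N b W S] (b l i) := by
  refine Measurable.mono (ma := MeasurableSpace.comap (b l i) inferInstance)
    (comap_measurable _) ?_ le_rfl
  exact le_iSup₂_of_le (f := fun p _ => MeasurableSpace.comap (param L N b W p) inferInstance)
    (Sum.inl ⟨(l, i), h1, h2, hi⟩) hl le_rfl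

lemma measurable_layerAlg_weight {S : Set ℕ} {l i j : ℕ} (h1 : 1 ≤ l) (h2 : l ≤ L + 1)
    (hi : i < N l) (hj : j < N (l - 1)) (hl : l ∈ S) :
    Measurable[layerAlg L N b W S] (W l i j) := by
  refine Measurable.mono (ma := MeasurableSpace.comap (W l i j) inferInstance)
    (comap_measurable _) ?_ le_rfl
  exact le_iSup₂_of_le (f := fun p _ => MeasurableSpace.comap (param L N b W p) inferInstance)
    (Sum.inr ⟨(l, i, j), h1, h2, hi, hj⟩) hl le_rfl

/-- The parameters of layer `l`, arranged by neurons. -/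
def layerParam (b : ℕ → ℕ → Ω → ℝ) (W : ℕ → ℕ → ℕ → Ω → ℝ) (l m k : ℕ) (ω : Ω) (i : Fin m)
    (o : Option (Fin k)) : ℝ :=
  o.elim (b l i ω) fun j => W l i j ω

end

section

variable {Ω : Type*} [MeasurableSpace Ω] {P : Measure Ω} {Cb CW : ℝ} {L : ℕ}
  {N : ℕ → ℕ} {b : ℕ → ℕ → Ω → ℝ} {W : ℕ → ℕ → ℕ → Ω → ℝ} {n₀ : ℕ} {x : Fin n₀ → ℝ}

lemma indep_layerAlg (hinit : IsGaussianInit P Cb CW L N b W) (hb : ∀ l i, Measurable (b l i))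
    (hW : ∀ l i j, Measurable (W l i j)) {S T : Set ℕ} (hST : Disjoint S T) :
    Indep (layerAlg L N b W S) (layerAlg L N b W T) P := by
  refine indep_iSup_of_disjoint (fun p => ?_) hinit.indep.iIndep (hST.preimage _)
  rcases p with p | p
  exacts [(hb _ _).comap_le, (hW _ _ _).comap_le]

lemma measurable_layerParam {l m k : ℕ} (hb : ∀ i < m, Measurable (b l i))
    (hW : ∀ i < m, ∀ j < k, Measurable (W l i j)) : Measurable (layerParam b W l m k) := by
  refine measurable_pi_iff.2 fun i => measurable_pi_iff.2 fun o => ?_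
  cases o with
  | none => exact hb i i.2
  | some j => exact hW i i.2 j j.2

/-- The parameters of one layer form a subfamily of all parameters along an injection, so their
joint law is a product over pairs (neuron, input); currying groups it by neurons. -/
lemma map_layerParam (hinit : IsGaussianInit P Cb CW L N b W) (hb : ∀ l i, Measurable (b l i))
    (hW : ∀ l i j, Measurable (W l i j)) {l m k : ℕ} (h1 : 1 ≤ l) (h2 : l ≤ L + 1) (hm : N l = m)
    (hk : N (l - 1) = k) :
    P.map (layerParam b W l m k) = Measure.pi fun _ => Measure.pi fun o : Option (Fin k) =>
      gaussianReal 0 (o.elim Cb.toNNReal fun _ => (CW / k).toNNReal) := by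
  set ι : Fin m × Option (Fin k) → BiasIndex L N ⊕ WeightIndex L N := fun p =>
    p.2.elim (Sum.inl ⟨(l, p.1), h1, h2, hm ▸ p.1.2⟩)
      fun j => Sum.inr ⟨(l, p.1, j), h1, h2, hm ▸ p.1.2, hk ▸ j.2⟩ with hι
  have hinj : Function.Injective ι := by
    rintro ⟨i, o⟩ ⟨i', o'⟩ h
    cases o <;> cases o' <;> simp [hι, Fin.ext_iff] at h ⊢ <;> exact h
  set μ : Fin m → Option (Fin k) → Measure ℝ := fun _ o =>
    gaussianReal 0 (o.elim Cb.toNNReal fun _ => (CW / k).toNNReal) with hμ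
  have hind : iIndepFun (fun p => param L N b W (ι p)) P := hinit.indep.precomp hinj
  have hmeas : ∀ p, Measurable (param L N b W (ι p)) := by
    rintro ⟨i, o⟩
    cases o
    exacts [hb _ _, hW _ _ _]
  have hlaw : ∀ p : Fin m × Option (Fin k), P.map (param L N b W (ι p)) = μ p.1 p.2 := by
    rintro ⟨i, o⟩
    cases o with
    | none => exact (hinit.bias ⟨(l, i), h1, h2, hm ▸ i.2⟩).map_eq
    | some j =>
      have := (hinit.weight ⟨(l, i, j), h1, h2, hm ▸ i.2, hk ▸ j.2⟩).map_eq
      simp only [hk] at this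
      exact this
  have hjoint := hind.map_fun_eq_infinitePi_map hmeas
  simp_rw [hlaw] at hjoint
  have hcurry := Measure.infinitePi_map_curry μ
  rw [← hjoint, Measure.map_map (by fun_prop) (measurable_pi_iff.2 hmeas)] at hcurry
  have hfun : layerParam b W l m k =
      MeasurableEquiv.curry (Fin m) (Option (Fin k)) ℝ ∘ fun ω p => param L N b W (ι p) ω := by
    ext ω i o
    cases o <;> rfl
  rw [hfun, hcurry]
  simp_rw [Measure.infinitePi_eq_pi]
  rfl

/-- The law of a layer of pre-activations. -/
lemma map_preact [IsProbabilityMeasure P] (hCb : 0 ≤ Cb) (hCW : 0 < CW)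
    (hinit : IsGaussianInit P Cb CW L N b W)
    (hb : ∀ l i, Measurable (b l i)) (hW : ∀ l i j, Measurable (W l i j)) (hN : N 0 = n₀)
    {ℓ m : ℕ} (hℓ : ℓ ≤ L) (hm : N (ℓ + 1) = m) :
    P.map (fun ω (i : Fin m) => preact relu N b W x ℓ i ω) =
      ((varLaw Cb CW N x ℓ).prod (stdPi m)).map fun p i => √p.1 * p.2 i := by
  induction ℓ generalizing m with
  | zero =>
    -- The input plays the role of the previous activations; being constant, it is independent of
    -- everything.
    have h := map_layer_eq (P := P) hCb hCW (Z := fun _ => x) (θ := layerParam b W 1 m n₀)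
      measurable_const (measurable_layerParam (fun i _ => hb _ _) fun i _ j _ => hW _ _ _)
      (indepFun_const_left _ _) (map_layerParam hinit hb hW le_rfl (by omega) hm hN)
    rw [Measure.map_const, measure_univ, one_smul] at h
    simp only [varLaw, initVar, ← pow_two]
    exact h
  | succ ℓ ih =>
    have hm' : N (ℓ + 2) = m := hm
    set k := N (ℓ + 1) with hk
    have ih := ih (m := k) (by omega) rfl
    have hθm := measurable_layerParam (l := ℓ + 2) (m := m) (k := k)
      (fun i _ => hb (ℓ + 2) i) fun i _ j _ => hW (ℓ + 2) i j
    have hpre : ∀ j, j < k → Measurable (preact relu N b W x ℓ j) := fun j hj =>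
      measurable_preact measurable_relu hN x ℓ (fun _ _ _ _ _ => hb _ _)
        (fun _ _ _ _ _ _ _ => hW _ _ _) hj
    have hvec : Measurable fun ω (j : Fin k) => preact relu N b W x ℓ j ω :=
      measurable_pi_iff.2 fun j => hpre j j.2
    have hZm : Measurable fun ω (j : Fin k) => relu (preact relu N b W x ℓ j ω) :=
      measurable_relu_preact hN x ℓ (fun _ _ _ _ _ => hb _ _) fun _ _ _ _ _ _ _ => hW _ _ _
    have hind : IndepFun (fun ω (j : Fin k) => relu (preact relu N b W x ℓ j ω))
        (layerParam b W (ℓ + 2) m k) P := by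
      -- The previous activations depend on the parameters of layers up to ℓ + 1 only, the new
      -- parameters belong to layer ℓ + 2.
      have hdisj : Disjoint (Set.Iic (ℓ + 1)) {ℓ + 2} := by simp
      have := indep_layerAlg hinit hb hW hdisj
      rw [IndepFun_iff_Indep]
      refine indep_of_indep_of_le_left (indep_of_indep_of_le_right this ?_) ?_
      · refine Measurable.comap_le (m₁ := layerAlg L N b W {ℓ + 2}) ?_
        refine @measurable_layerParam Ω (layerAlg L N b W {ℓ + 2}) b W _ _ _ (fun i hi => ?_)
          fun i hi j hj => ?_
        · exact measurable_layerAlg_bias (by omega) (by omega) (by omega) rfl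
        · exact measurable_layerAlg_weight (by omega) (by omega) (by omega) hj rfl
      · refine Measurable.comap_le (m₁ := layerAlg L N b W (Set.Iic (ℓ + 1))) ?_
        refine @measurable_relu_preact Ω (layerAlg L N b W (Set.Iic (ℓ + 1)))
          N b W n₀ hN x ℓ (fun l i h1 h2 hi => ?_) (fun l i j h1 h2 hi hj => ?_)
        · exact measurable_layerAlg_bias h1 (by omega) hi h2
        · exact measurable_layerAlg_weight h1 (by omega) hi hj h2
    have h := map_layer_eq (P := P) hCb hCW hZm hθm hind
      (map_layerParam hinit hb hW (by omega) (by omega) hm rfl)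
    -- By induction the previous layer is √g times a standard Gaussian vector, so homogeneity pulls
    -- g out of the mean of squares and one step of `varLaw` appears.
    have hvar : P.map (fun ω => Cb + CW / k * ∑ j : Fin k, relu (preact relu N b W x ℓ j ω) ^ 2) =
        varLaw Cb CW N x (ℓ + 1) := by
      have hrelu := measurable_relu
      have hG : Measurable fun z : Fin k → ℝ => Cb + CW / k * ∑ j, relu (z j) ^ 2 := by fun_prop
      have hr := (continuous_reluMean k).measurable
      rw [show (fun ω => Cb + CW / k * ∑ j : Fin k, relu (preact relu N b W x ℓ j ω) ^ 2) =
        (fun z : Fin k → ℝ => Cb + CW / k * ∑ j, relu (z j) ^ 2) ∘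
          fun ω (j : Fin k) => preact relu N b W x ℓ j ω from rfl,
        ← Measure.map_map hG hvec, ih, Measure.map_map hG (by fun_prop), varLaw, reluMeanLaw, ← hk]
      have hprod := Measure.map_prod_map (varLaw Cb CW N x ℓ) (stdPi k) (f := id) (g := reluMean k)
        measurable_id hr
      rw [Measure.map_id] at hprod
      rw [hprod, Measure.map_map (by fun_prop) (by fun_prop)]
      congr 1
      ext p
      simp only [Function.comp_apply, relu_sq_mul_sqrt, Prod.map, id, reluMean, ← Finset.mul_sum]
      ring
    rw [hvar] at h
    rw [← h]
    congr 1
    ext ω i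
    rw [preact, ← hk, Finset.sum_range]
    rfl

/-- Parameters that are only a.e. measurable can be replaced by measurable ones. -/
lemma exists_measurable_init (hinit : IsGaussianInit P Cb CW L N b W) (hN : N 0 = n₀) :
    ∃ (b' : ℕ → ℕ → Ω → ℝ) (W' : ℕ → ℕ → ℕ → Ω → ℝ), IsGaussianInit P Cb CW L N b' W' ∧
      (∀ l i, Measurable (b' l i)) ∧ (∀ l i j, Measurable (W' l i j)) ∧
      ∀ ℓ ≤ L, ∀ i < N (ℓ + 1), preact relu N b W x ℓ i =ᵐ[P] preact relu N b' W' x ℓ i := by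
  classical
  -- Nothing is assumed about parameters outside the index range; where no measurable version
  -- exists, 0 is a harmless default.
  let mk : (Ω → ℝ) → Ω → ℝ := fun f => if h : AEMeasurable f P then h.mk f else 0
  have mk_meas : ∀ f, Measurable (mk f) := by
    intro f
    simp only [mk]
    split_ifs with h
    exacts [h.measurable_mk, measurable_zero]
  have mk_ae : ∀ f, AEMeasurable f P → f =ᵐ[P] mk f := by
    intro f h
    simp only [mk, h, dif_pos]
    exact h.ae_eq_mk
  have hb : ∀ l i, 1 ≤ l → l ≤ L + 1 → i < N l → b l i =ᵐ[P] mk (b l i) := fun l i h1 h2 hi =>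
    mk_ae _ (hinit.bias ⟨(l, i), h1, h2, hi⟩).aemeasurable
  have hW : ∀ l i j, 1 ≤ l → l ≤ L + 1 → i < N l → j < N (l - 1) → W l i j =ᵐ[P] mk (W l i j) :=
    fun l i j h1 h2 hi hj => mk_ae _ (hinit.weight ⟨(l, i, j), h1, h2, hi, hj⟩).aemeasurable
  refine ⟨fun l i => mk (b l i), fun l i j => mk (W l i j), ⟨fun p => ?_, fun p => ?_, ?_⟩,
    fun _ _ => mk_meas _, fun _ _ _ => mk_meas _, ?_⟩
  · exact (hinit.bias p).congr (hb _ _ p.2.1 p.2.2.1 p.2.2.2).symm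
  · exact (hinit.weight p).congr (hW _ _ _ p.2.1 p.2.2.1 p.2.2.2.1 p.2.2.2.2).symm
  · refine hinit.indep.congr fun p => ?_
    rcases p with p | p
    exacts [hb _ _ p.2.1 p.2.2.1 p.2.2.2, hW _ _ _ p.2.1 p.2.2.1 p.2.2.2.1 p.2.2.2.2]
  · intro ℓ
    induction ℓ with
    | zero =>
      intro _ i hi
      have h2 : ∀ᵐ ω ∂P, ∀ r : Fin n₀, W 1 i r ω = mk (W 1 i r) ω := ae_all_iff.2 fun r =>
        hW 1 i r le_rfl (by omega) hi (by simp [hN])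
      filter_upwards [hb 1 i le_rfl (by omega) hi, h2] with ω h3 h4
      simp only [preact, h3, h4]
    | succ ℓ ih =>
      intro hℓ i hi
      have h2 : ∀ᵐ ω ∂P, ∀ j : Fin (N (ℓ + 1)), W (ℓ + 2) i j ω = mk (W (ℓ + 2) i j) ω ∧
          preact relu N b W x ℓ j ω =
            preact relu N (fun l i => mk (b l i)) (fun l i j => mk (W l i j)) x ℓ j ω := by
        refine ae_all_iff.2 fun j => ?_
        filter_upwards [hW (ℓ + 2) i j (by omega) (by omega) hi j.2, ih (by omega) j j.2]
          with ω h3 h4 using ⟨h3, h4⟩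
      filter_upwards [hb (ℓ + 2) i (by omega) (by omega) hi, h2] with ω h3 h4
      simp only [preact, h3]
      congr 1
      refine Finset.sum_congr rfl fun j hj => ?_
      have := h4 ⟨j, Finset.mem_range.1 hj⟩
      rw [this.1, this.2]

lemma aemeasurable_smul_output (hinit : IsGaussianInit P Cb CW L N b W) (hN : N 0 = n₀) {m : ℕ}
    (hm : N (L + 1) = m) (s : ℝ) : AEMeasurable (fun ω => s • output relu L m N b W x ω) P := by
  obtain ⟨b', W', -, hb, hW, hae⟩ := exists_measurable_init (x := x) hinit hN
  have h : AEMeasurable (fun ω (i : Fin m) => preact relu N b W x L i ω) P :=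
    aemeasurable_pi_iff.2 fun i =>
      (measurable_preact measurable_relu hN x L (fun _ _ _ _ _ => hb _ _)
        (fun _ _ _ _ _ _ _ => hW _ _ _) (hm ▸ i.2)).aemeasurable.congr
          (hae L le_rfl i (hm ▸ i.2)).symm
  have hS : Measurable fun z : Fin m → ℝ => s • (WithLp.toLp 2 z : EuclideanSpace ℝ (Fin m)) := by
    fun_prop
  exact hS.comp_aemeasurable h

/-- The law of the output of the network, up to a factor. -/
lemma map_smul_output [IsProbabilityMeasure P] (hCb : 0 ≤ Cb) (hCW : 0 < CW)
    (hinit : IsGaussianInit P Cb CW L N b W) (hN : N 0 = n₀) {m : ℕ} (hm : N (L + 1) = m) (s : ℝ) :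
    P.map (fun ω => s • output relu L m N b W x ω) =
      ((varLaw Cb CW N x L).prod
        (Measure.pi fun _ : Fin m => (gaussianReal 0 1).map fun t => s * t)).map
          fun p => √p.1 • WithLp.toLp 2 p.2 := by
  obtain ⟨b', W', hinit', hb, hW, hae⟩ := exists_measurable_init (x := x) hinit hN
  have h1 : (fun ω => s • output relu L m N b W x ω) =ᵐ[P]
      fun ω => s • output relu L m N b' W' x ω := by
    have : ∀ᵐ ω ∂P, ∀ i : Fin m, preact relu N b W x L i ω = preact relu N b' W' x L i ω :=
      ae_all_iff.2 fun i => hae L le_rfl i (hm ▸ i.2)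
    filter_upwards [this] with ω h
    simp only [output, h]
  rw [Measure.map_congr h1]
  have h2 := map_preact (x := x) hCb hCW hinit' hb hW hN le_rfl hm
  have hvec : Measurable fun ω (i : Fin m) => preact relu N b' W' x L i ω :=
    measurable_pi_iff.2 fun i => measurable_preact measurable_relu hN x L
      (fun _ _ _ _ _ => hb _ _) (fun _ _ _ _ _ _ _ => hW _ _ _) (hm ▸ i.2)
  have hS : Measurable fun z : Fin m → ℝ => s • (WithLp.toLp 2 z : EuclideanSpace ℝ (Fin m)) := by
    fun_prop
  have hM : Measurable fun t : Fin m → ℝ => fun i => s * t i := by fun_prop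
  rw [show (fun ω => s • output relu L m N b' W' x ω) =
    (fun z : Fin m → ℝ => s • (WithLp.toLp 2 z : EuclideanSpace ℝ (Fin m))) ∘
      fun ω (i : Fin m) => preact relu N b' W' x L i ω from rfl,
    ← Measure.map_map hS hvec, h2, Measure.map_map hS (by fun_prop),
    ← Measure.pi_map_pi (μ := fun _ : Fin m => gaussianReal 0 1) (f := fun _ t => s * t)
      fun _ => by fun_prop]
  have hprod := Measure.map_prod_map (varLaw Cb CW N x L) (stdPi m) (f := id)
    (g := fun t : Fin m → ℝ => fun i => s * t i) measurable_id hM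
  rw [Measure.map_id] at hprod
  rw [hprod, Measure.map_map (by fun_prop) (by fun_prop)]
  congr 1
  ext p i
  simp
  ring

end

/-! ### Identification of the rate functions -/

lemma meanSq_relu_nonneg (q : ℝ) : 0 ≤ meanSq relu q := by
  rw [meanSq_relu]
  positivity

lemma Delta_nonneg (r r₀ : ℝ) : 0 ≤ Delta r r₀ := by
  unfold Delta; split_ifs <;> simp

lemma Delta_self (r : ℝ) : Delta r r = 0 := if_pos rfl

lemma Delta_of_ne {r r₀ : ℝ} (h : r ≠ r₀) : Delta r r₀ = ⊤ := if_neg h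

/-- The mean 1/2 costs nothing for any γ. -/
lemma reluRate_half (γ : ℝ≥0∞) : reluRate γ (1 / 2) = 0 := by
  by_cases h : γ = ⊤
  · rw [h, reluRate_top, Delta_self]
  · have h1 := kappaStar_one_eq (c := 0) (by norm_num)
    have h2 : cubicRatio (invSqrt 0) = 1 / 2 := by norm_num [cubicRatio, invSqrt]
    have h3 : logMgf 0 = 0 := by simp [logMgf, invSqrt]
    rw [h2, h3] at h1
    rw [reluRate_of_ne_top h, h1]
    simp

lemma reluRate_nonneg (γ : ℝ≥0∞) (s : ℝ) : 0 ≤ reluRate γ s := by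
  by_cases h : γ = ⊤
  · rw [h, reluRate_top]
    exact Delta_nonneg _ _
  · rw [reluRate_of_ne_top h]
    exact mul_nonneg (EReal.coe_nonneg.2 ENNReal.toReal_nonneg) (kappaStar_nonneg s)

section

variable {Cb CW : ℝ} {γ : ℝ≥0∞}

lemma J_relu_of_pos (hCW : 0 < CW) {g : ℝ} (hg : 0 < g) (s : ℝ) :
    J relu Cb CW γ (Cb + CW * (max g 0 * s)) g = reluRate γ s := by
  rw [max_eq_left hg.le]
  by_cases h : γ = ⊤
  · subst h
    rw [reluRate_top]
    unfold J Delta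
    rw [if_pos rfl, meanSq_relu, max_eq_left hg.le]
    have : Cb + CW * (g * s) = Cb + CW * (g / 2) ↔ s = 1 / 2 := by
      rw [add_right_inj, mul_right_inj' hCW.ne', div_eq_mul_one_div, mul_right_inj' hg.ne']
    simp only [this]
  · rw [reluRate_of_ne_top h, J, if_neg h, kappaStar_relu_of_pos hg]
    congr 2
    field_simp
    ring

/-- Without variance all activations vanish, so the next variance can only be C_b. -/
lemma J_relu_of_nonpos (hγ : 1 ≤ γ) (hCW : 0 < CW) {g : ℝ} (hg : g ≤ 0) (y : ℝ) :
    J relu Cb CW γ y g = Delta y Cb := by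
  by_cases h : γ = ⊤
  · subst h
    rw [J, if_pos rfl, meanSq_relu, max_eq_right hg]
    simp
  · rw [J, if_neg h, kappaStar_relu_of_nonpos hg, Delta]
    have : (y - Cb) / CW = 0 ↔ y = Cb := by
      rw [div_eq_zero_iff, or_iff_left hCW.ne', sub_eq_zero]
    simp only [this]
    split_ifs
    · simp
    · exact EReal.coe_mul_top_of_pos (ENNReal.toReal_pos (zero_lt_one.trans_le hγ).ne' h)

/-- Equality may fail for g ≤ 0, where every `s` leads to the same variance C_b. -/
lemma J_relu_le (hγ : 1 ≤ γ) (hCW : 0 < CW) (g s : ℝ) :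
    J relu Cb CW γ (Cb + CW * (max g 0 * s)) g ≤ reluRate γ s := by
  rcases lt_or_ge 0 g with hg | hg
  · exact (J_relu_of_pos hCW hg s).le
  · rw [J_relu_of_nonpos hγ hCW hg, max_eq_right hg, zero_mul, mul_zero, add_zero, Delta_self]
    exact reluRate_nonneg γ s

lemma exists_reluRate_eq_J (hγ : 1 ≤ γ) (hCW : 0 < CW) (y g : ℝ) (h : J relu Cb CW γ y g ≠ ⊤) :
    ∃ s, Cb + CW * (max g 0 * s) = y ∧ reluRate γ s = J relu Cb CW γ y g := by
  rcases lt_or_ge 0 g with hg | hg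
  · have hs : Cb + CW * (max g 0 * ((y - Cb) / (CW * g))) = y := by
      rw [max_eq_left hg.le]
      field_simp
      ring
    refine ⟨(y - Cb) / (CW * g), hs, ?_⟩
    rw [← J_relu_of_pos (Cb := Cb) hCW hg, hs]
  · rw [J_relu_of_nonpos hγ hCW hg] at h ⊢
    have hy : y = Cb := by
      by_contra hne
      exact h (Delta_of_ne hne)
    subst hy
    refine ⟨1 / 2, ?_, ?_⟩
    · rw [max_eq_right hg]; ring
    · rw [reluRate_half, Delta_self]

lemma J_relu_nonneg (hγ : 1 ≤ γ) (hCW : 0 < CW) (y g : ℝ) : 0 ≤ J relu Cb CW γ y g := by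
  by_cases h : J relu Cb CW γ y g = ⊤
  · rw [h]; exact le_top
  · obtain ⟨s, -, hs⟩ := exists_reluRate_eq_J hγ hCW y g h
    rw [← hs]
    exact reluRate_nonneg γ s

/-- This makes the constraint g ≥ C_b automatic wherever the cost is finite. -/
lemma J_relu_eq_top_of_lt (hγ : 1 ≤ γ) (hCW : 0 < CW) {y : ℝ} (hy : y < Cb) (g : ℝ) :
    J relu Cb CW γ y g = ⊤ := by
  rcases lt_or_ge 0 g with hg | hg
  · by_cases h : γ = ⊤
    · rw [J, if_pos h, Delta_of_ne]
      have := mul_nonneg hCW.le (meanSq_relu_nonneg g)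
      linarith
    · rw [J, if_neg h, kappaStar_relu_of_pos hg, kappaStar_one_of_neg]
      · exact EReal.coe_mul_top_of_pos (ENNReal.toReal_pos (zero_lt_one.trans_le hγ).ne' h)
      · exact div_neg_of_neg_of_pos (div_neg_of_neg_of_pos (by linarith) hCW) hg
  · rw [J_relu_of_nonpos hγ hCW hg, Delta_of_ne hy.ne]

end

/-- The rate function of the variance of layer `ℓ + 1`, in recursive form. -/
noncomputable def varRate (Cb CW : ℝ) (γ : ℕ → ℝ≥0∞) {n₀ : ℕ} (x : Fin n₀ → ℝ) : ℕ → ℝ → EReal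
  | 0 => fun g => Delta g (initVar Cb CW x)
  | ℓ + 1 => fun y => ⨅ (g : ℝ) (s : ℝ) (_ : Cb + CW * (max g 0 * s) = y),
      varRate Cb CW γ x ℓ g + reluRate (γ (ℓ + 1)) s

section

variable {Cb CW : ℝ} {γ : ℕ → ℝ≥0∞} {n₀ : ℕ} {x : Fin n₀ → ℝ}

lemma varRate_nonneg (ℓ : ℕ) (g : ℝ) : 0 ≤ varRate Cb CW γ x ℓ g := by
  induction ℓ generalizing g with
  | zero => exact Delta_nonneg _ _
  | succ ℓ ih =>
    exact le_iInf fun g => le_iInf fun s => le_iInf fun _ => add_nonneg (ih g) (reluRate_nonneg _ _)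

/-- Translates the infimum over pairs produced by the contraction principle into one over the
previous variance alone. -/
lemma varRate_succ (hCW : 0 < CW) {ℓ : ℕ} (hγ : 1 ≤ γ (ℓ + 1)) (y : ℝ) :
    varRate Cb CW γ x (ℓ + 1) y =
      ⨅ g, varRate Cb CW γ x ℓ g + J relu Cb CW (γ (ℓ + 1)) y g := by
  refine le_antisymm (le_iInf fun g => ?_) (le_iInf fun g => le_iInf fun s => le_iInf fun hs => ?_)
  · by_cases h : J relu Cb CW (γ (ℓ + 1)) y g = ⊤
    · rw [h, EReal.add_top_of_ne_bot]
      · exact le_top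
      · exact (lt_of_lt_of_le EReal.bot_lt_zero (varRate_nonneg ℓ g)).ne'
    · obtain ⟨s, hs, hJ⟩ := exists_reluRate_eq_J hγ hCW y g h
      rw [← hJ]
      exact iInf_le_of_le g (iInf_le_of_le s (iInf_le _ hs))
  · subst hs
    exact iInf_le_of_le g (add_le_add le_rfl (J_relu_le hγ hCW g s))

lemma le_of_varRate_ne_top (hCW : 0 < CW) {ℓ : ℕ} (hγ : 1 ≤ γ (ℓ + 1)) {y : ℝ}
    (h : varRate Cb CW γ x (ℓ + 1) y ≠ ⊤) : Cb ≤ y := by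
  by_contra hy
  refine h ?_
  rw [varRate_succ hCW hγ, iInf_eq_top]
  intro g
  rw [J_relu_eq_top_of_lt hγ hCW (not_le.1 hy), EReal.add_top_of_ne_bot]
  exact (lt_of_lt_of_le EReal.bot_lt_zero (varRate_nonneg ℓ g)).ne'

lemma varRate_le_sum (hCW : 0 < CW) {ℓ : ℕ} (hγ : ∀ l, 1 ≤ l → l ≤ ℓ → 1 ≤ γ l) {p : ℕ → ℝ}
    (hp : p 0 = initVar Cb CW x) :
    varRate Cb CW γ x ℓ (p ℓ) ≤
      ∑ l ∈ Finset.range ℓ, J relu Cb CW (γ (l + 1)) (p (l + 1)) (p l) := by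
  induction ℓ with
  | zero => simp [varRate, hp, Delta_self]
  | succ ℓ ih =>
    rw [varRate_succ hCW (hγ _ (by omega) le_rfl), Finset.sum_range_succ]
    exact iInf_le_of_le (p ℓ) (add_le_add (ih fun l h1 h2 => hγ l h1 (by omega)) le_rfl)

/-- Nested infima are unfolded into one path of nearly minimal cost; strict inequalities avoid any
question of attainment. -/
lemma exists_path_of_varRate_lt (hCW : 0 < CW) {ℓ : ℕ} (hγ : ∀ l, 1 ≤ l → l ≤ ℓ → 1 ≤ γ l)
    {y c : ℝ} (h : varRate Cb CW γ x ℓ y < c) :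
    ∃ p : ℕ → ℝ, (p 0 = initVar Cb CW x ∧ p ℓ = y ∧ ∀ l, 1 ≤ l → l < ℓ → Cb ≤ p l) ∧
      ∑ l ∈ Finset.range ℓ, J relu Cb CW (γ (l + 1)) (p (l + 1)) (p l) < c := by
  induction ℓ generalizing y c with
  | zero =>
    have hy : y = initVar Cb CW x := by
      by_contra hne
      simp [varRate, Delta_of_ne hne] at h
    refine ⟨fun _ => y, ⟨hy, rfl, fun l h1 h2 => by omega⟩, ?_⟩
    simpa [varRate, hy, Delta_self] using h
  | succ ℓ ih =>
    have hγ' := hγ (ℓ + 1) (by omega) le_rfl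
    rw [varRate_succ hCW hγ', iInf_lt_iff] at h
    obtain ⟨g, hg⟩ := h
    obtain ⟨c₁, c₂, h1, h2, rfl⟩ :=
      exists_real_add_eq_of_add_lt (varRate_nonneg ℓ g) (J_relu_nonneg hγ' hCW y g) hg
    obtain ⟨p, ⟨hp0, hpℓ, hpC⟩, hsum⟩ := ih (fun l h1 h2 => hγ l h1 (by omega)) h1
    refine ⟨Function.update p (ℓ + 1) y, ⟨?_, Function.update_self .., fun l hl1 hl2 => ?_⟩, ?_⟩
    · rwa [Function.update_of_ne (by omega)]
    · rw [Function.update_of_ne (by omega)]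
      rcases (Nat.lt_succ_iff_lt_or_eq.1 hl2) with hl | rfl
      · exact hpC l hl1 hl
      -- The former endpoint has become an interior point of the path; its finite cost forces it to
      -- be at least C_b.
      · obtain ⟨l, rfl⟩ := Nat.exists_eq_succ_of_ne_zero (by omega : l ≠ 0)
        rw [hpℓ]
        exact le_of_varRate_ne_top hCW (hγ _ (by omega) (by omega)) (h1.trans (EReal.coe_lt_top _)).ne
    · rw [Finset.sum_range_succ, Function.update_self, Function.update_of_ne (by omega), hpℓ,
        EReal.coe_add]
      refine EReal.add_lt_add (lt_of_le_of_lt (le_of_eq ?_) hsum) h2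
      refine Finset.sum_congr rfl fun l hl => ?_
      have := Finset.mem_range.1 hl
      rw [Function.update_of_ne (by omega), Function.update_of_ne (by omega)]

lemma rateG_eq_varRate (hCW : 0 < CW) {L : ℕ} (hγ : ∀ l, 1 ≤ l → l ≤ L → 1 ≤ γ l) (g : ℝ) :
    rateG relu Cb CW L γ x g = varRate Cb CW γ x L g := by
  refine le_antisymm (EReal.le_of_forall_lt_iff_le.1 fun c hc => ?_)
    (le_iInf₂ fun p hp => ?_)
  · obtain ⟨p, hp, hsum⟩ := exists_path_of_varRate_lt hCW hγ hc
    exact (iInf₂_le p hp).trans hsum.le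
  · rw [← hp.2.1]
    exact varRate_le_sum hCW hγ hp.1

lemma rateLD_eq (hCW : 0 < CW) {L m : ℕ} (hL : 1 ≤ L) (hγ : ∀ l, 1 ≤ l → l ≤ L → 1 ≤ γ l)
    (z : EuclideanSpace ℝ (Fin m)) :
    rateLD relu Cb CW L m γ x z =
      ⨅ (g : ℝ) (t : Fin m → ℝ) (_ : √g • (WithLp.toLp 2 t : EuclideanSpace ℝ (Fin m)) = z),
        varRate Cb CW γ x L g + ((∑ i, t i ^ 2 / 2 : ℝ) : EReal) := by
  have hnorm : ∀ r : EuclideanSpace ℝ (Fin m), ‖r‖ ^ 2 / 2 = ∑ i, r i ^ 2 / 2 := fun r => by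
    rw [EuclideanSpace.real_norm_sq_eq, Finset.sum_div]
  obtain ⟨l, rfl⟩ := Nat.exists_eq_succ_of_ne_zero (by omega : L ≠ 0)
  unfold rateLD
  simp_rw [rateG_eq_varRate hCW hγ]
  refine le_antisymm (le_iInf fun g => le_iInf fun t => le_iInf fun ht => ?_)
    (le_iInf fun g => le_iInf fun r => le_iInf fun hr => ?_)
  · by_cases hg : varRate Cb CW γ x (l + 1) g = ⊤
    · rw [Nat.succ_eq_add_one, hg, EReal.top_add_coe]
      exact le_top
    · refine iInf_le_of_le g (iInf_le_of_le (WithLp.toLp 2 t) (iInf_le_of_le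
        ⟨le_of_varRate_ne_top hCW (hγ _ (by omega) le_rfl) hg, ht⟩ ?_))
      rw [hnorm]
  · refine iInf_le_of_le g (iInf_le_of_le (WithLp.ofLp r) (iInf_le_of_le hr.2 ?_))
    rw [hnorm]

lemma le_limVar (hCW : 0 < CW) (ℓ : ℕ) : Cb ≤ limVar relu Cb CW x ℓ := by
  cases ℓ with
  | zero =>
    have : 0 ≤ CW / n₀ * ∑ r, x r * x r :=
      mul_nonneg (div_nonneg hCW.le (Nat.cast_nonneg _))
        (Finset.sum_nonneg fun r _ => mul_self_nonneg _)
    simp only [limVar, initVar]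
    linarith
  | succ ℓ =>
    have := mul_nonneg hCW.le (meanSq_relu_nonneg (limVar relu Cb CW x ℓ))
    simp only [limVar]
    linarith

/-- When all ratios are infinite every step is deterministic, and only the path of limiting
variances has finite cost. -/
lemma varRate_top (hCW : 0 < CW) (ℓ : ℕ) (g : ℝ) :
    varRate Cb CW (fun _ => ⊤) x ℓ g = Delta g (limVar relu Cb CW x ℓ) := by
  induction ℓ generalizing g with
  | zero => rfl
  | succ ℓ ih =>
    rw [varRate_succ hCW le_top]
    simp_rw [ih, J, if_true, limVar]
    refine le_antisymm (iInf_le_of_le (limVar relu Cb CW x ℓ) ?_) (le_iInf fun g' => ?_)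
    · rw [Delta_self, zero_add]
    · by_cases h : g' = limVar relu Cb CW x ℓ
      · rw [h, Delta_self, zero_add]
      · rw [Delta_of_ne h, EReal.top_add_of_ne_bot]
        · exact le_top
        · exact (lt_of_lt_of_le EReal.bot_lt_zero (Delta_nonneg _ _)).ne'

lemma rateLD_top (hCW : 0 < CW) (L m : ℕ) :
    rateLD relu Cb CW L m (fun _ => ⊤) x = rateMD relu Cb CW L m x := by
  ext z
  unfold rateLD rateMD
  simp_rw [rateG_eq_varRate (γ := fun _ => ⊤) hCW (fun _ _ _ => le_top), varRate_top hCW]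
  refine le_antisymm (le_iInf₂ fun r hr => ?_)
    (le_iInf fun g => le_iInf fun r => le_iInf fun hr => ?_)
  · refine iInf_le_of_le (limVar relu Cb CW x L) (iInf_le_of_le r (iInf_le_of_le
      ⟨le_limVar hCW L, hr⟩ ?_))
    rw [Delta_self, zero_add]
  · by_cases h : g = limVar relu Cb CW x L
    · subst h
      rw [Delta_self, zero_add]
      exact iInf₂_le r hr.2
    · rw [Delta_of_ne h, EReal.top_add_coe]
      exact le_top

lemma rateMD_of_pos {L m : ℕ} (h : 0 < limVar relu Cb CW x L) (z : EuclideanSpace ℝ (Fin m)) :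
    rateMD relu Cb CW L m x z =
      ((‖(√(limVar relu Cb CW x L))⁻¹ • z‖ ^ 2 / 2 : ℝ) : EReal) := by
  have hs : √(limVar relu Cb CW x L) ≠ 0 := (Real.sqrt_pos.2 h).ne'
  unfold rateMD
  refine le_antisymm (iInf₂_le_of_le ((√(limVar relu Cb CW x L))⁻¹ • z) (smul_inv_smul₀ hs z) le_rfl)
    (le_iInf₂ fun r hr => ?_)
  rw [← hr, inv_smul_smul₀ hs]

end

/-! ### Large and moderate deviations of the network -/

lemma localLDP_varLaw {Cb CW : ℝ} {L n₀ : ℕ} {N : ℕ → ℕ → ℕ} {γ : ℕ → ℝ≥0∞} (x : Fin n₀ → ℝ)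
    {v : ℕ → ℝ} (hv : IsSpeed v) (hγ : ∀ l, 1 ≤ l → l ≤ L → 1 ≤ γ l)
    (hN : ∀ l, 1 ≤ l → l ≤ L →
      Tendsto (fun n => ENNReal.ofReal ((N n l : ℝ) / v n)) atTop (𝓝 (γ l)))
    {ℓ : ℕ} (hℓ : ℓ ≤ L) :
    LocalLDP (fun n => varLaw Cb CW (N n) x ℓ) v (varRate Cb CW γ x ℓ) := by
  induction ℓ with
  | zero => exact localLDP_dirac hv _
  | succ ℓ ih =>
    exact (ih (by omega)).map_prod
      (localLDP_reluMeanLaw (k := fun n => N n (ℓ + 1)) (hγ _ (by omega) hℓ) hv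
        (hN _ (by omega) hℓ)) hv
      (Φ := fun p => Cb + CW * (max p.1 0 * p.2)) (by fun_prop) (by fun_prop)

/-- The speed is left free, so that the same statement yields both large deviations (v = v_n^*) and
moderate deviations (v = 1/a_n). -/
lemma localLDP_output {Ω : Type*} [MeasurableSpace Ω] {P : Measure Ω} [IsProbabilityMeasure P]
    {Cb CW : ℝ} {L n₀ m : ℕ} {N : ℕ → ℕ → ℕ} {γ : ℕ → ℝ≥0∞} {b : ℕ → ℕ → ℕ → Ω → ℝ}
    {W : ℕ → ℕ → ℕ → ℕ → Ω → ℝ} (x : Fin n₀ → ℝ) (hCb : 0 ≤ Cb) (hCW : 0 < CW) (hL : 1 ≤ L)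
    (hinit : ∀ n, IsGaussianInit P Cb CW L (N n) (b n) (W n)) (hN0 : ∀ n, N n 0 = n₀)
    (hNL : ∀ n, N n (L + 1) = m) {v : ℕ → ℝ} (hv : IsSpeed v)
    (hγ : ∀ l, 1 ≤ l → l ≤ L → 1 ≤ γ l)
    (hN : ∀ l, 1 ≤ l → l ≤ L →
      Tendsto (fun n => ENNReal.ofReal ((N n l : ℝ) / v n)) atTop (𝓝 (γ l))) :
    LocalLDP (fun n => P.map fun ω => (√(v n))⁻¹ • output relu L m (N n) (b n) (W n) x ω) v
      (rateLD relu Cb CW L m γ x) := by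
  have h := (localLDP_varLaw (Cb := Cb) (CW := CW) x hv hγ hN le_rfl).map_prod
    ((localLDP_gaussian hv).pi (m := m) hv) hv
    (Φ := fun p => √p.1 • (WithLp.toLp 2 p.2 : EuclideanSpace ℝ (Fin m)))
    (by fun_prop) (by fun_prop)
  rw [funext (rateLD_eq (m := m) hCW hL hγ)]
  simp_rw [fun n => map_smul_output (x := x) hCb hCW (hinit n) (hN0 n) (hNL n)]
  exact h

end GaussianNN

theorem mainTheorem3 :
    -- the explicit form of `κ(·; q)` for ReLU
    (∀ q : ℝ, 0 < q → ∀ η : ℝ,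
      (η < 1 / (2 * q) → kappa relu η q =
        ((Real.log (((1 - 2 * η * q) ^ (-(1 / 2) : ℝ) + 1) / 2) : ℝ) : EReal)) ∧
      (1 / (2 * q) ≤ η → kappa relu η q = ⊤)) ∧
    (∀ η : ℝ, kappa relu η 0 = 0) ∧
    -- `κ(·; q)` is finite near `0`, essentially smooth and lower semicontinuous
    (∀ q : ℝ, 0 ≤ q →
      (∀ᶠ η in 𝓝 (0 : ℝ), kappa relu η q ≠ ⊥ ∧ kappa relu η q ≠ ⊤) ∧
      EssentiallySmooth (fun η => kappa relu η q) ∧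
      LowerSemicontinuous (fun η => kappa relu η q)) ∧
    -- the explicit form of `κ*(·; q)`
    Set.BijOn cubicRatio (Set.Ioi 0) (Set.Ioi 0) ∧
    (∀ q : ℝ, 0 < q →
      (∀ η : ℝ, η < 1 / (2 * q) → HasDerivAt (fun t => (kappa relu t q).toReal)
        (q * (1 - 2 * η * q) ^ (-(3 / 2) : ℝ) / ((1 - 2 * η * q) ^ (-(1 / 2) : ℝ) + 1)) η) ∧
      (∀ y : ℝ, 0 < y →
        (∀ η : ℝ, (η < 1 / (2 * q) ∧ deriv (fun t => (kappa relu t q).toReal) η = y) ↔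
          η = etaStar y q) ∧
        (1 - 2 * etaStar y q * q) ^ (-(1 / 2) : ℝ) = cubicRatioInv (y / q) ∧
        kappaStar relu y q = ((etaStar y q * y : ℝ) : EReal) - kappa relu (etaStar y q) q ∧
        kappaStar relu y q = (((1 - (cubicRatioInv (y / q) ^ 2)⁻¹) / (2 * q) * y
          - Real.log ((cubicRatioInv (y / q) + 1) / 2) : ℝ) : EReal)) ∧
      kappaStar relu 0 q = ((Real.log 2 : ℝ) : EReal) ∧
      (∀ y : ℝ, y < 0 → kappaStar relu y q = ⊤)) ∧
    -- large and moderate deviations for the ReLU network at one input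
    (∀ (Ω : Type*) [MeasurableSpace Ω] (P : Measure Ω) [IsProbabilityMeasure P]
      (Cb CW : ℝ) (L n₀ m : ℕ) (N : ℕ → ℕ → ℕ) (lh : ℕ) (γ : ℕ → ℝ≥0∞)
      (b : ℕ → ℕ → ℕ → Ω → ℝ) (W : ℕ → ℕ → ℕ → ℕ → Ω → ℝ) (x : Fin n₀ → ℝ),
      0 ≤ Cb → 0 < CW → 1 ≤ L → WidthCondition L n₀ m N lh γ →
      (∀ n, IsGaussianInit P Cb CW L (N n) (b n) (W n)) →
      -- large deviations
      (IsGoodRateFunction (rateLD relu Cb CW L m γ x) ∧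
        SatisfiesLDP
          (fun n => P.map fun ω => (√(N n lh : ℝ))⁻¹ • output relu L m (N n) (b n) (W n) x ω)
          (fun n => (N n lh : ℝ)) (rateLD relu Cb CW L m γ x)) ∧
      -- moderate deviations
      (∀ a : ℕ → ℝ, (∀ n, 0 < a n) → Tendsto a atTop (𝓝 0) →
        Tendsto (fun n => a n * (N n lh : ℝ)) atTop atTop →
        IsGoodRateFunction (rateMD relu Cb CW L m x) ∧
        SatisfiesLDP
          (fun n => P.map fun ω => √(a n) • output relu L m (N n) (b n) (W n) x ω)
          (fun n => 1 / a n) (rateMD relu Cb CW L m x)) ∧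
      (0 < limVar relu Cb CW x L → ∀ z : EuclideanSpace ℝ (Fin m),
        rateMD relu Cb CW L m x z =
          ((‖(√(limVar relu Cb CW x L))⁻¹ • z‖ ^ 2 / 2 : ℝ) : EReal))) := by
  refine ⟨fun q hq η => ⟨fun h => ?_, kappa_relu_of_ge hq⟩, kappa_relu_of_nonpos le_rfl,
    fun q hq => ⟨kappa_finite_near_zero hq, essentiallySmooth_kappa hq, lowerSemicontinuous_kappa hq⟩,
    cubicRatio_bijOn, fun q hq => ⟨fun η h => ?_, fun y hy => ⟨deriv_kappa_eq_iff hq hy, ?_, ?_, ?_⟩,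
      ?_, fun y hy => ?_⟩, ?_⟩
  · rw [kappa_relu_of_lt hq h, logMgf, invSqrt, mul_assoc]
  · rw [← cubicRatio_invSqrt_eq hq h]
    exact hasDerivAt_kappa hq h
  · rw [← invSqrt_etaStar hq hy, invSqrt, mul_assoc]
  · rw [kappaStar_relu_eq hq hy, kappa_relu_of_lt hq (etaStar_lt hq hy), EReal.coe_sub]
  · rw [kappaStar_relu_eq hq hy, logMgf, invSqrt_etaStar hq hy, etaStar]
  · rw [kappaStar_relu_of_pos hq, zero_div, kappaStar_one_zero]
  · rw [kappaStar_relu_of_pos hq, kappaStar_one_of_neg (div_neg_of_neg_of_pos hy hq)]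
  · intro Ω _ P _ Cb CW L n₀ m N lh γ b W x hCb hCW hL hw hinit
    have hlh : ∀ n, (0 : ℝ) < N n lh := fun n => by
      exact_mod_cast hw.pos n lh (hw.ref.2.trans (Nat.le_succ L))
    have hratio : ∀ l, 1 ≤ l → l ≤ L →
        Tendsto (fun n => ENNReal.ofReal ((N n l : ℝ) / N n lh)) atTop (𝓝 (γ l)) := by
      intro l h1 h2
      refine (hw.ratio l h1 h2).congr fun n => ?_
      rw [ENNReal.ofReal_div_of_pos (hlh n), ENNReal.ofReal_natCast, ENNReal.ofReal_natCast]
    refine ⟨?_, fun a ha ha0 hav => ?_, fun h z => rateMD_of_pos h z⟩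
    · have hv : IsSpeed fun n => (N n lh : ℝ) :=
        ⟨hlh, tendsto_natCast_atTop_atTop.comp (hw.diverge lh hw.ref.1 hw.ref.2)⟩
      have hm : ∀ n, AEMeasurable (fun ω => (√(N n lh : ℝ))⁻¹ •
          output relu L m (N n) (b n) (W n) x ω) P := fun n =>
        aemeasurable_smul_output (hinit n) (hw.input n) (hw.output n) _
      have := fun n => Measure.isProbabilityMeasure_map (hm n)
      have h := localLDP_output x hCb hCW hL hinit hw.input hw.output hv hw.one_le hratio
      exact ⟨h.isGoodRateFunction hv, h.satisfiesLDP hv⟩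
    · have hv : IsSpeed fun n => 1 / a n := by
        refine ⟨fun n => one_div_pos.2 (ha n), ?_⟩
        simp_rw [one_div]
        exact tendsto_inv_nhdsGT_zero.comp
          (tendsto_nhdsWithin_iff.2 ⟨ha0, Eventually.of_forall fun n => ha n⟩)
      have hm : ∀ n, AEMeasurable (fun ω => √(a n) •
          output relu L m (N n) (b n) (W n) x ω) P := fun n =>
        aemeasurable_smul_output (hinit n) (hw.input n) (hw.output n) _
      have := fun n => Measure.isProbabilityMeasure_map (hm n)
      have hN : ∀ l, 1 ≤ l → l ≤ L →
          Tendsto (fun n => ENNReal.ofReal ((N n l : ℝ) / (1 / a n))) atTop (𝓝 ⊤) := by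
        intro l h1 h2
        refine ENNReal.tendsto_ofReal_nhds_top.2
          (tendsto_atTop_mono' _ ?_ (hav.const_mul_atTop (show (0 : ℝ) < 1 / 2 by norm_num)))
        -- As γ_ℓ ≥ 1 > 1/2, eventually n_ℓ ≥ v_n^*/2, hence a_n n_ℓ ≥ a_n v_n^*/2 tends to infinity
        -- in every layer.
        have hlt : ENNReal.ofReal (1 / 2) < γ l := lt_of_lt_of_le
          (by rw [← ENNReal.ofReal_one]; exact (ENNReal.ofReal_lt_ofReal_iff one_pos).2 (by norm_num))
          (hw.one_le l h1 h2)
        filter_upwards [(hratio l h1 h2).eventually_const_lt hlt] with n hn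
        have h3 := (ENNReal.ofReal_lt_ofReal_iff_of_nonneg (by norm_num)).1 hn
        rw [lt_div_iff₀ (hlh n)] at h3
        rw [div_div_eq_mul_div, div_one]
        nlinarith [ha n]
      have h := localLDP_output (γ := fun _ => ⊤) x hCb hCW hL hinit hw.input hw.output hv
        (fun _ _ _ => le_top) hN
      have hs : ∀ n, (√(1 / a n))⁻¹ = √(a n) := fun n => by
        rw [one_div, Real.sqrt_inv, inv_inv]
      simp_rw [hs, rateLD_top hCW] at h
      exact ⟨h.isGoodRateFunction hv, h.satisfiesLDP hv⟩
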